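/- Fix countably infinite sets $N_C, N_R, N_I$ of concept names, role names and individual names. A role is a role name $r$ or its inverse $r^-$, with $(r^-)^-=r$. A Horn-$\mathcal{ALCHIF}$ TBox is a finite set of concept inclusions $L\sqsubseteq R$, role inclusions $r\sqsubseteq s$ and functionality assertions $\mathsf{func}(r)$ ($r,s$ roles), where $$R ::= \top\mid\bot\mid A\mid\neg A\mid R\sqcap R'\mid \neg L\sqcup R\mid\exists r.R\mid\forall r.R,\qquad L::=\top\mid\bot\mid A\mid L\sqcap L'\mid L\sqcup L'\mid\exists r.L$$ with $A\in N_C$. Functional roles are assumed to have no subroles: if $r\sqsubseteq s\in\mathcal T$, then neither $\mathsf{func}(s)\in\mathcal T$ nor $\mathsf{func}(s^-)\in\mathcal T$ (note that $r\sqsubseteq s$ is equivalent to $r^-\sqsubseteq s^-$). Interpretations are first-order style interpretations satisfying the standard name assumption ($N_I$ is contained in the domain and $a^{\mathcal I}=a$). An ABox $\mathcal A$ is a finite set of assertions $A(a)$ and $r(a,b)$ with $A\in N_C$, $r\in N_R$, $a,b\in N_I$; $\mathrm{ind}(\mathcal A)$ is the set of individuals occurring in it. $\mathcal A$ is consistent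 with $\mathcal T$ if they have a common model. $\mathcal A$ is tree-shaped if it contains no assertion $r(a,a)$, the undirected graph $(\mathrm{ind}(\mathcal A),\{\{a,b\}\mid r(a,b)\in\mathcal A\})$ is a (non-empty) tree, and for any $a,b$ at most one role assertion in $\mathcal A$ involves both $a$ and $b$. A conjunctive query (CQ) $q(\mathbf x)=\exists\mathbf y\,\varphi(\mathbf x,\mathbf y)$ is given by a finite set of atoms $A(z)$, $r(z,z')$ over the answer variables $\mathbf x$ and the quantified variables $\mathbf y$; it is weakly tree-shaped if it contains no atom $r(z,z)$ and the undirected graph $(\mathbf x\cup\mathbf y,\{\{z,z'\}\mid r(z,z')\in q\})$ is a tree. We write $\mathcal T,\mathcal A\models q(\mathbf a)$ if every model of $\mathcal T$ and $\mathcal A$ has a match of $q$ sending $\mathbf x$ to $\mathbf a$. Let $\Sigma_A,\Sigma_Q$ be signatures (sets of concept and role names). $\mathcal T_1$ $(\Sigma_A,\Sigma_Q)$-CQ entails $\mathcal T_2$ if for all $\Sigma_A$-ABoxes $\mathcal A$ consistent with $\mathcal T_1$ and with $\mathcal T_2$, all $\Sigma_Q$-CQs $q(\mathbf x)$ and all tuples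 $\mathbf a$ over $\mathrm{ind}(\mathcal A)$, $\mathcal T_2,\mathcal A\models q(\mathbf a)$ implies $\mathcal T_1,\mathcal A\models q(\mathbf a)$. A triple $(\mathcal A,q,\mathbf a)$ violating this is a witness to non-entailment. We write $\mathcal T_1\models^{\mathrm{RI}}_{\Sigma_A,\Sigma_Q}\mathcal T_2$ if for all roles $r$ over $\Sigma_A$ and $s$ over $\Sigma_Q$ (role names or inverses), $\mathcal T_2\models r\sqsubseteq s$ implies $\mathcal T_1\models r\sqsubseteq s$. **Proposition.** Let $\mathcal T_1,\mathcal T_2$ be Horn-$\mathcal{ALCHIF}$ TBoxes (in which functional roles have no subroles) with $\mathcal T_1\models^{\mathrm{RI}}_{\Sigma_A,\Sigma_Q}\mathcal T_2$. If $\mathcal T_1$ does not $(\Sigma_A,\Sigma_Q)$-CQ entail $\mathcal T_2$, then there is a witness $(\mathcal A,q,\mathbf a)$ to non-entailment such that $q$ is weakly tree-shaped and has at most one answer variable, and $\mathcal A$ is tree-shaped; the only exception to the last point is the degenerate case in which every witness has the empty ABox, and then $\mathcal A=\emptyset$. -/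

import Mathlib

namespace HornDL

/-- A role: a role name or the inverse of a role name. -/
inductive Role (NR : Type) : Type
  | name (r : NR) : Role NR
  | inv (r : NR) : Role NR

/-- The inverse of a role; the inverse of an inverse role is the role name itself. -/
def Role.inverse {NR : Type} : Role NR → Role NR
  | .name r => .inv r
  | .inv r => .name r

/-- The role name underlying a role. -/
def Role.base {NR : Type} : Role NR → NR
  | .name r => r
  | .inv r => r

/-- Concepts of the description logic ALCI. -/
inductive Concept (NC NR : Type) : Type
  | top : Concept NC NR
  | bot : Concept NC NR
  | atom (A : NC) : Concept NC NR
  | neg (C : Concept NC NR) : Concept NC NR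
  | inf (C D : Concept NC NR) : Concept NC NR
  | sup (C D : Concept NC NR) : Concept NC NR
  | ex (r : Role NR) (C : Concept NC NR) : Concept NC NR
  | all (r : Role NR) (C : Concept NC NR) : Concept NC NR

/-- The concepts `L` allowed on the left-hand side of a Horn concept inclusion. -/
inductive Concept.IsLeft {NC NR : Type} : Concept NC NR → Prop
  | top : IsLeft .top
  | bot : IsLeft .bot
  | atom (A : NC) : IsLeft (.atom A)
  | inf {C D : Concept NC NR} : IsLeft C → IsLeft D → IsLeft (.inf C D)
  | sup {C D : Concept NC NR} : IsLeft C → IsLeft D → IsLeft (.sup C D)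
  | ex (r : Role NR) {C : Concept NC NR} : IsLeft C → IsLeft (.ex r C)

/-- The concepts `R` allowed on the right-hand side of a Horn concept inclusion. -/
inductive Concept.IsRight {NC NR : Type} : Concept NC NR → Prop
  | top : IsRight .top
  | bot : IsRight .bot
  | atom (A : NC) : IsRight (.atom A)
  | negAtom (A : NC) : IsRight (.neg (.atom A))
  | inf {C D : Concept NC NR} : IsRight C → IsRight D → IsRight (.inf C D)
  | negSup {C D : Concept NC NR} : Concept.IsLeft C → IsRight D → IsRight (.sup (.neg C) D)
  | ex (r : Role NR) {C : Concept NC NR} : IsRight C → IsRight (.ex r C)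
  | all (r : Role NR) {C : Concept NC NR} : IsRight C → IsRight (.all r C)

/-- A Horn-ALCHIF TBox: a finite set of concept inclusions `L ⊑ R` (the pairs in `ci`), role
inclusions `r ⊑ s` (the pairs in `ri`) and functionality assertions `func(r)` (the roles
in `fa`). -/
structure TBox (NC NR : Type) : Type where
  ci : Finset (Concept NC NR × Concept NC NR)
  ri : Finset (Role NR × Role NR)
  fa : Finset (Role NR)
  horn : ∀ p ∈ ci, p.1.IsLeft ∧ p.2.IsRight

/-- Functional roles have no subroles. The role inclusion `r ⊑ s` makes `r` a subrole of `s` and,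
being the same statement, the inverse of `r` a subrole of the inverse of `s`. -/
def TBox.FunctionalRolesHaveNoSubroles {NC NR : Type} (T : TBox NC NR) : Prop :=
  ∀ r s : Role NR, (r, s) ∈ T.ri → s ∉ T.fa ∧ s.inverse ∉ T.fa

/-- Concept assertions `A(a)` and role assertions `r(a,b)`. -/
inductive Assertion (NC NR NI : Type) : Type
  | concept (A : NC) (a : NI) : Assertion NC NR NI
  | role (r : NR) (a b : NI) : Assertion NC NR NI

/-- The individuals that occur in an assertion. -/
def Assertion.inds {NC NR NI : Type} : Assertion NC NR NI → Set NI
  | .concept _ a => {a}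
  | .role _ a b => {a, b}

/-- An ABox: a finite set of assertions. -/
abbrev ABox (NC NR NI : Type) : Type := Finset (Assertion NC NR NI)

/-- The set `ind(𝒜)` of individuals that occur in an ABox. -/
def ABox.ind {NC NR NI : Type} (A : ABox NC NR NI) : Set NI :=
  {a | ∃ α ∈ A, a ∈ α.inds}

/-- The undirected graph of an ABox: the vertices are its individuals, the edges the pairs
`{a,b}` with a role assertion `r(a,b)`. -/
def ABox.graph {NC NR NI : Type} (A : ABox NC NR NI) : SimpleGraph A.ind :=
  SimpleGraph.fromRel fun a b => ∃ r : NR, Assertion.role r a.1 b.1 ∈ A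

/-- Tree-shaped ABoxes: no reflexive role assertions, the undirected graph is a tree, and
at most one role assertion involves any two given individuals. -/
def ABox.TreeShaped {NC NR NI : Type} (A : ABox NC NR NI) : Prop :=
  (∀ (r : NR) (a : NI), Assertion.role r a a ∉ A) ∧
  A.graph.IsTree ∧
  (∀ (r s : NR) (a b c d : NI), Assertion.role r a b ∈ A → Assertion.role s c d ∈ A →
    ((c = a ∧ d = b) ∨ (c = b ∧ d = a)) →
      (Assertion.role r a b : Assertion NC NR NI) = Assertion.role s c d)

/-- An interpretation. Individual names are interpreted by an injective map into the domain: this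
is the standard name assumption (individual names are elements of the domain and denote
themselves) up to renaming the elements of the domain. -/
structure Interpretation (NC NR NI : Type) : Type 1 where
  Δ : Type
  nonempty : Nonempty Δ
  conc : NC → Set Δ
  rel : NR → Set (Δ × Δ)
  ind : NI → Δ
  ind_injective : Function.Injective ind

namespace Interpretation

variable {NC NR NI : Type}

/-- The extension of a role. -/
def role (I : Interpretation NC NR NI) : Role NR → Set (I.Δ × I.Δ)
  | .name r => I.rel r
  | .inv r => {p | (p.2, p.1) ∈ I.rel r}

/-- The extension of a concept. -/
def ext (I : Interpretation NC NR NI) : Concept NC NR → Set I.Δ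
  | .top => Set.univ
  | .bot => ∅
  | .atom A => I.conc A
  | .neg C => (I.ext C)ᶜ
  | .inf C D => I.ext C ∩ I.ext D
  | .sup C D => I.ext C ∪ I.ext D
  | .ex r C => {d | ∃ e, (d, e) ∈ I.role r ∧ e ∈ I.ext C}
  | .all r C => {d | ∀ e, (d, e) ∈ I.role r → e ∈ I.ext C}

/-- `I ⊨ C ⊑ D`. -/
def SatCI (I : Interpretation NC NR NI) (C D : Concept NC NR) : Prop :=
  I.ext C ⊆ I.ext D

/-- `I ⊨ r ⊑ s`. -/
def SatRI (I : Interpretation NC NR NI) (r s : Role NR) : Prop :=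
  I.role r ⊆ I.role s

/-- `I ⊨ func(r)`. -/
def SatFA (I : Interpretation NC NR NI) (r : Role NR) : Prop :=
  ∀ d e e' : I.Δ, (d, e) ∈ I.role r → (d, e') ∈ I.role r → e = e'

/-- `I ⊨ A(a)` and `I ⊨ r(a,b)`. -/
def SatAssertion (I : Interpretation NC NR NI) : Assertion NC NR NI → Prop
  | .concept A a => I.ind a ∈ I.conc A
  | .role r a b => (I.ind a, I.ind b) ∈ I.rel r

/-- `I` is a model of the TBox `T`. -/
def ModelsTBox (I : Interpretation NC NR NI) (T : TBox NC NR) : Prop :=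
  (∀ p ∈ T.ci, I.SatCI p.1 p.2) ∧ (∀ p ∈ T.ri, I.SatRI p.1 p.2) ∧ (∀ r ∈ T.fa, I.SatFA r)

/-- `I` is a model of the ABox `A`. -/
def ModelsABox (I : Interpretation NC NR NI) (A : ABox NC NR NI) : Prop :=
  ∀ α ∈ A, I.SatAssertion α

end Interpretation

/-- The ABox `A` is consistent with the TBox `T`: they have a common model. -/
def Consistent {NC NR NI : Type} (T : TBox NC NR) (A : ABox NC NR NI) : Prop :=
  ∃ I : Interpretation NC NR NI, I.ModelsTBox T ∧ I.ModelsABox A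

/-- `T ⊨ r ⊑ s`; the interpretations are those with individual names from `NI`. -/
def TBox.EntailsRI {NC NR : Type} (NI : Type) (T : TBox NC NR) (r s : Role NR) : Prop :=
  ∀ I : Interpretation NC NR NI, I.ModelsTBox T → I.SatRI r s

/-- A signature: a set of concept names and role names. -/
structure Signature (NC NR : Type) : Type where
  concepts : Set NC
  roles : Set NR

/-- The atoms `A(z)` and `r(z,z')` of conjunctive queries. Variables are natural numbers. -/
inductive QAtom (NC NR : Type) : Type
  | concept (A : NC) (z : ℕ) : QAtom NC NR
  | role (r : NR) (z z' : ℕ) : QAtom NC NR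

/-- The variables that occur in an atom. -/
def QAtom.vars {NC NR : Type} : QAtom NC NR → Set ℕ
  | .concept _ z => {z}
  | .role _ z z' => {z, z'}

/-- A conjunctive query: a tuple of answer variables, a finite set of quantified
variables and a finite set of atoms over these variables. -/
structure CQ (NC NR : Type) : Type where
  answer : List ℕ
  quantified : Finset ℕ
  atoms : Finset (QAtom NC NR)
  disjoint : ∀ z ∈ answer, z ∉ quantified
  closed : ∀ α ∈ atoms, ∀ z ∈ α.vars, z ∈ answer ∨ z ∈ quantified

/-- All variables of a conjunctive query. -/
def CQ.vars {NC NR : Type} (q : CQ NC NR) : Set ℕ :=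
  {z | z ∈ q.answer ∨ z ∈ q.quantified}

/-- The undirected graph of a conjunctive query: the vertices are its variables, the edges
the pairs `{z,z'}` with an atom `r(z,z')`. -/
def CQ.graph {NC NR : Type} (q : CQ NC NR) : SimpleGraph q.vars :=
  SimpleGraph.fromRel fun z z' => ∃ r : NR, QAtom.role r z.1 z'.1 ∈ q.atoms

/-- Weakly tree-shaped conjunctive queries; multi-edges are permitted. -/
def CQ.WeaklyTreeShaped {NC NR : Type} (q : CQ NC NR) : Prop :=
  (∀ (r : NR) (z : ℕ), QAtom.role r z z ∉ q.atoms) ∧ q.graph.IsTree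

/-- `π` is a match of `q` in `I`. Only the values of `π` on the variables of `q` matter. -/
def CQ.IsMatch {NC NR NI : Type} (q : CQ NC NR) (I : Interpretation NC NR NI) (π : ℕ → I.Δ) :
    Prop :=
  (∀ (A : NC) (z : ℕ), QAtom.concept A z ∈ q.atoms → π z ∈ I.conc A) ∧
  (∀ (r : NR) (z z' : ℕ), QAtom.role r z z' ∈ q.atoms → (π z, π z') ∈ I.rel r)

/-- `I ⊨ q(a₁,…,aₙ)`: some match of `q` sends the tuple of answer variables
to `(a₁,…,aₙ)`. -/
def Interpretation.SatCQ {NC NR NI : Type} (I : Interpretation NC NR NI) (q : CQ NC NR)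
    (a : List NI) : Prop :=
  ∃ π : ℕ → I.Δ, q.IsMatch I π ∧ q.answer.map π = a.map I.ind

/-- `T, A ⊨ q(a)`: the tuple `a` is a certain answer to `q` over `A` given `T`. -/
def CertainAnswer {NC NR NI : Type} (T : TBox NC NR) (A : ABox NC NR NI) (q : CQ NC NR)
    (a : List NI) : Prop :=
  ∀ I : Interpretation NC NR NI, I.ModelsTBox T → I.ModelsABox A → I.SatCQ q a

/-- `A` is a `Σ`-ABox. -/
def ABox.Over {NC NR NI : Type} (A : ABox NC NR NI) (S : Signature NC NR) : Prop :=
  (∀ (B : NC) (a : NI), Assertion.concept B a ∈ A → B ∈ S.concepts) ∧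
  (∀ (r : NR) (a b : NI), Assertion.role r a b ∈ A → r ∈ S.roles)

/-- `q` is a `Σ`-CQ. -/
def CQ.Over {NC NR : Type} (q : CQ NC NR) (S : Signature NC NR) : Prop :=
  (∀ (B : NC) (z : ℕ), QAtom.concept B z ∈ q.atoms → B ∈ S.concepts) ∧
  (∀ (r : NR) (z z' : ℕ), QAtom.role r z z' ∈ q.atoms → r ∈ S.roles)

/-- `T₁` `(ΣA,ΣQ)`-CQ entails `T₂`. -/
def CQEntails {NC NR : Type} (NI : Type) (SA SQ : Signature NC NR) (T₁ T₂ : TBox NC NR) : Prop :=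
  ∀ A : ABox NC NR NI, A.Over SA → Consistent T₁ A → Consistent T₂ A →
    ∀ q : CQ NC NR, q.Over SQ → ∀ a : List NI, (∀ b ∈ a, b ∈ A.ind) →
      CertainAnswer T₂ A q a → CertainAnswer T₁ A q a

/-- `(A, q, a)` is a witness to the failure of `(ΣA,ΣQ)`-CQ entailment of `T₂` by `T₁`. -/
def IsWitness {NC NR NI : Type} (SA SQ : Signature NC NR) (T₁ T₂ : TBox NC NR)
    (A : ABox NC NR NI) (q : CQ NC NR) (a : List NI) : Prop :=
  A.Over SA ∧ Consistent T₁ A ∧ Consistent T₂ A ∧ q.Over SQ ∧ (∀ b ∈ a, b ∈ A.ind) ∧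
    CertainAnswer T₂ A q a ∧ ¬ CertainAnswer T₁ A q a

/-- There are no `ΣA`-role `r` and `ΣQ`-role `s` (role names or inverses) such that
`T₂ ⊨ r ⊑ s` but not `T₁ ⊨ r ⊑ s`. -/
def RIEntails {NC NR : Type} (NI : Type) (SA SQ : Signature NC NR) (T₁ T₂ : TBox NC NR) : Prop :=
  ∀ r s : Role NR, r.base ∈ SA.roles → s.base ∈ SQ.roles →
    T₂.EntailsRI NI r s → T₁.EntailsRI NI r s

end HornDL

open HornDL

/-! A witness is cut into tree-shaped pieces, one of which remains a witness once its ABox is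
unravelled. For a witness $(\mathcal A,q,\mathbf a)$, consider a model of $\mathcal T_2$ and
$\mathcal A$ made of a core, the individuals with the role edges of $\mathcal A$ closed under
subroles, and of trees grafted onto the core (`Core.graft_modelsTBox`). A match of $q$ in it
consists of role atoms between core elements and of connected pieces, each inside one tree.
Identifying variables with equal images makes a piece weakly tree-shaped. It meets the core at most
in the root of its tree, and a root in $\mathrm{ind}(\mathcal A)$ becomes the only answer variable.
If $\mathcal T_1$ entailed every piece over $\mathcal A$, the matches of the pieces in a model of
$\mathcal T_1$ and $\mathcal A$ would glue to a match of $q$: roots in $\mathrm{ind}(\mathcal A)$ go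
to their individuals, and role atoms between core elements follow from the role inclusion hypothesis
(`certainAnswer_of_tree_queries`).

It remains to pass from $\mathcal A$ to a finite tree, namely a truncated universal cover of
$\mathcal A$. A model of a TBox and $\mathcal A$ unravels into a model of the cover with a
homomorphism back (`exists_model_cover`). So the cover stays consistent with both TBoxes, and
whatever $\mathcal T_1$ entails over the cover it entails over $\mathcal A$. Conversely, a piece
must be certain for $\mathcal T_2$ over a deep enough cover. To this end the trees are taken from a
reduced product of models of the covers, each chosen to refute a given query if possible. Horn
TBoxes are preserved by reduced products (`reducedProduct.modelsTBox`), so this plays the part of a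
canonical model (`exists_canonical_core`). -/

namespace HornDL

/-! ### Roles and the generated subrole relation -/

section Basics

variable {NC NR NI : Type}

@[simp] theorem Role.inverse_inverse (r : Role NR) : r.inverse.inverse = r := by cases r <;> rfl

@[simp] theorem Interpretation.mem_role_inverse (I : Interpretation NC NR NI) (r : Role NR)
    (d e : I.Δ) : (d, e) ∈ I.role r.inverse ↔ (e, d) ∈ I.role r := by
  cases r <;> exact Iff.rfl

/-- The subrole relation generated by the role inclusions of a TBox. -/
def TBox.Sub (T : TBox NC NR) : Role NR → Role NR → Prop :=
  Relation.ReflTransGen fun r s => (r, s) ∈ T.ri ∨ (r.inverse, s.inverse) ∈ T.ri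

theorem TBox.Sub.inverse {T : TBox NC NR} {r s : Role NR} (h : T.Sub r s) :
    T.Sub r.inverse s.inverse := by
  induction h with
  | refl => exact .refl
  | tail _ h ih => exact ih.tail (by simpa [or_comm] using h)

theorem TBox.Sub.satRI {T : TBox NC NR} {r s : Role NR} (h : T.Sub r s)
    {I : Interpretation NC NR NI} (hI : I.ModelsTBox T) : I.SatRI r s := by
  induction h with
  | refl => exact fun _ h => h
  | tail _ h ih =>
    rintro ⟨d, e⟩ hde
    rcases h with h | h
    · exact hI.2.1 _ h (ih hde)
    · exact (I.mem_role_inverse _ _ _).1 (hI.2.1 _ h ((I.mem_role_inverse _ e d).2 (ih hde)))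

/-- The last inclusion of a nontrivial chain would give `s` a proper declared subrole. Hence an edge
of a functional role in a graft can only stem from that very role. -/
theorem TBox.FunctionalRolesHaveNoSubroles.eq_of_sub {T : TBox NC NR}
    (hT : T.FunctionalRolesHaveNoSubroles) {r s : Role NR} (hs : s ∈ T.fa) (h : T.Sub r s) :
    r = s := by
  rcases Relation.ReflTransGen.cases_tail h with h | ⟨t, -, h | h⟩
  · exact h.symm
  · exact absurd hs (hT _ _ h).1
  · exact absurd hs (by simpa using (hT _ _ h).2)

end Basics

/-! ### Grafting unravelled trees onto a relational core -/

section Graft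

variable {NC NR NI NI' : Type}

/-- Data for grafting trees unravelled from a model `P` of `T` onto a relational core with
vertices `NI`. The vertex `b` is to look like `point b`, and a core neighbour `c` of `b` takes the
place of the element `nbr ρ b c` of `P`. -/
structure Core (T : TBox NC NR) (P : Interpretation NC NR NI') (NI : Type) where
  edge : Role NR → NI → NI → Prop
  point : NI → P.Δ
  nbr : Role NR → NI → NI → P.Δ
  edge_inverse : ∀ {ρ b c}, edge ρ b c → edge ρ.inverse c b
  nbr_mem : ∀ {ρ b c}, edge ρ b c → (point b, nbr ρ b c) ∈ P.role ρ
  nbr_ext : ∀ {ρ b c}, edge ρ b c → ∀ C, point c ∈ P.ext C ↔ nbr ρ b c ∈ P.ext C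
  functional : ∀ {ρ b c c'}, ρ ∈ T.fa → edge ρ b c → edge ρ b c' → c = c'
  models : P.ModelsTBox T

namespace Core

variable {T : TBox NC NR} {P : Interpretation NC NR NI'} (S : Core T P NI)

/-- The element of `P` represented by a branch that starts at `b`. -/
def val (b : NI) : List (Role NR × P.Δ) → P.Δ
  | [] => S.point b
  | e :: _ => e.2

/-- The branch `w` at `b` is not extended by the `σ`-successor `e`, since the core or the
predecessor already provides it. -/
def Blocked (b : NI) : List (Role NR × P.Δ) → Role NR → P.Δ → Prop
  | [], σ, e => ∃ c, S.edge σ b c ∧ e = S.nbr σ b c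
  | (ρ, _) :: w, σ, e => σ = ρ.inverse ∧ e = S.val b w

/-- The branches of the tree grafted at `b`. -/
inductive Branch (b : NI) : List (Role NR × P.Δ) → Prop
  | nil : Branch b []
  | cons {w : List (Role NR × P.Δ)} {σ : Role NR} {e : P.Δ} : Branch b w →
      (S.val b w, e) ∈ P.role σ → ¬ S.Blocked b w σ e → Branch b ((σ, e) :: w)

/-- The role edges between core vertices and branches. -/
inductive Step : Role NR → NI × List (Role NR × P.Δ) → NI × List (Role NR × P.Δ) → Prop
  | core {σ ρ : Role NR} {b c : NI} : T.Sub σ ρ → S.edge σ b c → Step ρ (b, []) (c, [])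
  | down {σ ρ : Role NR} {b : NI} {w : List (Role NR × P.Δ)} {e : P.Δ} :
      T.Sub σ ρ → Step ρ (b, w) (b, (σ, e) :: w)
  | up {σ ρ : Role NR} {b : NI} {w : List (Role NR × P.Δ)} {e : P.Δ} :
      T.Sub σ.inverse ρ → Step ρ (b, (σ, e) :: w) (b, w)

variable {S}

theorem Step.inverse {ρ : Role NR} {m m' : NI × List (Role NR × P.Δ)} (h : S.Step ρ m m') :
    S.Step ρ.inverse m' m := by
  cases h with
  | core h he => exact .core h.inverse (S.edge_inverse he)
  | down h => exact .up h.inverse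
  | up h => exact .down (by simpa using h.inverse)

theorem Step.mono {ρ σ : Role NR} {m m' : NI × List (Role NR × P.Δ)} (h : S.Step ρ m m')
    (hs : T.Sub ρ σ) : S.Step σ m m' := by
  cases h with
  | core h he => exact .core (h.trans hs) he
  | down h => exact .down (h.trans hs)
  | up h => exact .up (h.trans hs)

variable (S)

/-- The core with all trees grafted onto it. -/
def graft [Nonempty NI] : Interpretation NC NR NI where
  Δ := {m : NI × List (Role NR × P.Δ) // S.Branch m.1 m.2}
  nonempty := (inferInstance : Nonempty NI).map fun b => ⟨(b, []), .nil⟩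
  conc A := {m | S.val m.1.1 m.1.2 ∈ P.conc A}
  rel r := {p | S.Step (.name r) p.1.1 p.2.1}
  ind b := ⟨(b, []), .nil⟩
  ind_injective := fun b c h => by simpa using h

variable [Nonempty NI]

theorem mem_graft_role {ρ : Role NR} {m m' : S.graft.Δ} :
    (m, m') ∈ S.graft.role ρ ↔ S.Step ρ m.1 m'.1 := by
  cases ρ with
  | name r => exact Iff.rfl
  | inv r => exact ⟨fun h => Step.inverse (ρ := .name r) h, fun h => Step.inverse (ρ := .inv r) h⟩

variable {S}

/-- Only tree edges are claimed to project to edges of `P`. A core edge need not, since `nbr` may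
differ from the point of the neighbour. -/
theorem Step.cases_val {ρ : Role NR} {m m' : S.graft.Δ} (h : S.Step ρ m.1 m'.1) :
    (m.1.2 = [] ∧ m'.1.2 = [] ∧ ∃ σ, T.Sub σ ρ ∧ S.edge σ m.1.1 m'.1.1) ∨
    ((S.val m.1.1 m.1.2, S.val m'.1.1 m'.1.2) ∈ P.role ρ ∧ m.1.1 = m'.1.1 ∧
      ∃ e, m'.1.2 = e :: m.1.2 ∨ m.1.2 = e :: m'.1.2) := by
  obtain ⟨m, hm⟩ := m
  obtain ⟨m', hm'⟩ := m'
  cases h with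
  | core h he => exact .inl ⟨rfl, rfl, _, h, he⟩
  | down h =>
    cases hm' with
    | cons _ hr _ => exact .inr ⟨h.satRI S.models hr, rfl, _, .inl rfl⟩
  | up h =>
    cases hm with
    | cons _ hr _ =>
      exact .inr ⟨h.satRI S.models ((P.mem_role_inverse _ _ _).2 hr), rfl, _, .inr rfl⟩

variable (S)

/-- The back condition of a bisimulation: a blocked successor is replaced by the core neighbour or
the predecessor that blocks it, and these satisfy the same concepts as `e`. -/
theorem exists_step {ρ : Role NR} (m : S.graft.Δ) {e : P.Δ}
    (he : (S.val m.1.1 m.1.2, e) ∈ P.role ρ) :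
    ∃ m' : S.graft.Δ, S.Step ρ m.1 m'.1 ∧
      ∀ C, S.val m'.1.1 m'.1.2 ∈ P.ext C ↔ e ∈ P.ext C := by
  obtain ⟨⟨b, w⟩, hm⟩ := m
  by_cases hb : S.Blocked b w ρ e
  · cases w with
    | nil =>
      obtain ⟨c, hc, rfl⟩ := hb
      exact ⟨⟨(c, []), .nil⟩, .core .refl hc, S.nbr_ext hc⟩
    | cons f w =>
      obtain ⟨σ, d⟩ := f
      obtain ⟨rfl, rfl⟩ := hb
      cases hm with
      | cons hw _ _ => exact ⟨⟨(b, w), hw⟩, .up .refl, fun _ => Iff.rfl⟩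
  · exact ⟨⟨(b, (ρ, e) :: w), .cons hm he hb⟩, .down .refl, fun _ => Iff.rfl⟩

theorem exists_of_step {ρ : Role NR} {m m' : S.graft.Δ} (h : S.Step ρ m.1 m'.1) :
    ∃ e, (S.val m.1.1 m.1.2, e) ∈ P.role ρ ∧
      ∀ C, S.val m'.1.1 m'.1.2 ∈ P.ext C ↔ e ∈ P.ext C := by
  rcases h.cases_val with ⟨h1, h2, σ, hs, he⟩ | ⟨h, -⟩
  · refine ⟨S.nbr σ m.1.1 m'.1.1, ?_, ?_⟩
    · rw [h1]
      exact hs.satRI S.models (S.nbr_mem he)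
    · rw [h2]
      exact S.nbr_ext he
  · exact ⟨_, h, fun _ => Iff.rfl⟩

/-- By `exists_step` and `exists_of_step`, `val` acts as a bisimulation up to agreement on concepts.
-/
theorem mem_graft_ext (C : Concept NC NR) (m : S.graft.Δ) :
    m ∈ S.graft.ext C ↔ S.val m.1.1 m.1.2 ∈ P.ext C := by
  induction C generalizing m with
  | top => exact Iff.rfl
  | bot => exact Iff.rfl
  | atom A => exact Iff.rfl
  | neg C ih => exact not_congr (ih m)
  | inf C D ihC ihD => exact and_congr (ihC m) (ihD m)
  | sup C D ihC ihD => exact or_congr (ihC m) (ihD m)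
  | ex r C ih =>
    constructor
    · rintro ⟨m', hr, hC⟩
      obtain ⟨e, he, hext⟩ := S.exists_of_step (S.mem_graft_role.1 hr)
      exact ⟨e, he, (hext C).1 ((ih m').1 hC)⟩
    · rintro ⟨e, he, hC⟩
      obtain ⟨m', hr, hext⟩ := S.exists_step m he
      exact ⟨m', S.mem_graft_role.2 hr, (ih m').2 ((hext C).2 hC)⟩
  | all r C ih =>
    constructor
    · intro h e he
      obtain ⟨m', hr, hext⟩ := S.exists_step m he
      exact (hext C).1 ((ih m').1 (h m' (S.mem_graft_role.2 hr)))
    · intro h m' hr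
      obtain ⟨e, he, hext⟩ := S.exists_of_step (S.mem_graft_role.1 hr)
      exact (ih m').2 ((hext C).2 (h e he))

/-- In `P` the `f`-successor is unique. So if the core or the predecessor provides one, any
`f`-child would represent the same element and is blocked; otherwise there is at most one child. -/
theorem graft_satFA (hT : T.FunctionalRolesHaveNoSubroles) {f : Role NR} (hf : f ∈ T.fa) :
    S.graft.SatFA f := by
  have hP := S.models.2.2 f hf
  intro m m₁ m₂ h₁ h₂
  rw [S.mem_graft_role] at h₁ h₂
  obtain ⟨m, hm⟩ := m
  obtain ⟨m₁, hm₁⟩ := m₁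
  obtain ⟨m₂, hm₂⟩ := m₂
  refine Subtype.ext ?_
  dsimp only at h₁ h₂
  have down_core : ∀ {b c : NI} {e : P.Δ}, S.Branch b [(f, e)] → ¬ S.edge f b c := by
    intro b c e hb hc
    cases hb with
    | cons _ hr hn => exact hn ⟨c, hc, hP _ _ _ hr (S.nbr_mem hc)⟩
  have down_up : ∀ {b : NI} {w : List (Role NR × P.Δ)} {σ : Role NR} {e d : P.Δ},
      σ.inverse = f → ¬ S.Branch b ((f, e) :: (σ, d) :: w) := by
    rintro b w σ e d rfl hb
    cases hb with
    | cons hw hr hn =>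
      cases hw with
      | cons _ hr' _ =>
        exact hn ⟨rfl, hP _ _ _ hr ((P.mem_role_inverse _ _ _).2 hr')⟩
  cases h₁ with
  | core h he =>
    obtain rfl := hT.eq_of_sub hf h
    cases h₂ with
    | core h' he' =>
      obtain rfl := hT.eq_of_sub hf h'
      exact congrArg (fun c => (c, [])) (S.functional hf he he')
    | down h' =>
      obtain rfl := hT.eq_of_sub hf h'
      exact absurd he (down_core hm₂)
  | down h =>
    obtain rfl := hT.eq_of_sub hf h
    cases h₂ with
    | core h' he' =>
      obtain rfl := hT.eq_of_sub hf h'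
      exact absurd he' (down_core hm₁)
    | down h' =>
      obtain rfl := hT.eq_of_sub hf h'
      cases hm₁ with
      | cons _ hr _ =>
        cases hm₂ with
        | cons _ hr' _ => exact congrArg (fun e => (_, (_, e) :: _)) (hP _ _ _ hr hr')
    | up h' => exact absurd hm₁ (down_up (hT.eq_of_sub hf h'))
  | up h =>
    cases h₂ with
    | down h' =>
      obtain rfl := hT.eq_of_sub hf h'
      exact absurd hm₂ (down_up (hT.eq_of_sub hf h))
    | up h' => rfl

theorem graft_modelsTBox (hT : T.FunctionalRolesHaveNoSubroles) : S.graft.ModelsTBox T := by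
  refine ⟨fun p hp m hm => ?_, fun p hp => ?_, fun f hf => S.graft_satFA hT hf⟩
  · exact (S.mem_graft_ext _ m).2 (S.models.1 p hp ((S.mem_graft_ext _ m).1 hm))
  · rintro ⟨m, m'⟩ h
    rw [S.mem_graft_role] at h ⊢
    exact h.mono (.single (.inl hp))

/-- The core satisfies the role assertions and the concept assertions true at its points. -/
theorem graft_modelsABox {A : ABox NC NR NI}
    (hc : ∀ B b, Assertion.concept B b ∈ A → S.point b ∈ P.conc B)
    (hr : ∀ r b c, Assertion.role r b c ∈ A → S.edge (.name r) b c) : S.graft.ModelsABox A := by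
  rintro (⟨B, b⟩ | ⟨r, b, c⟩) hα
  · exact hc B b hα
  · exact Step.core .refl (hr r b c hα)

end Core

end Graft


/-- A graph whose vertices are labelled injectively by lists is acyclic if adjacent vertices have
labels that differ by one leading element. -/
theorem isAcyclic_of_list_label {V α : Type} {G : SimpleGraph V} (f : V → List α)
    (hf : Function.Injective f)
    (hadj : ∀ x y, G.Adj x y → ∃ e, f y = e :: f x ∨ f x = e :: f y) : G.IsAcyclic := by
  have key : ∀ {u v : V} {e : α}, f u = e :: f v →
      ¬ (G.deleteEdges {s(u, v)}).Reachable u v := by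
    rintro u v e huv ⟨p⟩
    -- The labels with suffix `f u` form the subtree at `u`. By injectivity of `f`, only the deleted
    -- edge leaves it.
    have inv : ∀ {x y : V} (_ : (G.deleteEdges {s(u, v)}).Walk x y), f u <:+ f x →
        f u <:+ f y := by
      intro x y p
      induction p with
      | nil => exact id
      | @cons x z y hxz _ ih =>
        intro hx
        refine ih ?_
        rw [SimpleGraph.deleteEdges_adj] at hxz
        obtain ⟨d, h | h⟩ := hadj _ _ hxz.1
        · exact h ▸ hx.trans (List.suffix_cons _ _)
        · rw [h, List.suffix_cons_iff] at hx
          rcases hx with hx | hx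
          · have h1 : u = x := hf (hx.trans h.symm)
            have h2 : v = z := hf (by rw [huv] at hx; exact (List.cons.inj hx).2)
            exact absurd (by rw [h1, h2]; rfl) hxz.2
          · exact hx
    have := (inv p (List.suffix_refl _)).length_le
    simp [huv] at this
  rw [SimpleGraph.isAcyclic_iff_forall_adj_isBridge]
  intro x y hxy
  obtain ⟨e, h | h⟩ := hadj _ _ hxy
  · rw [Sym2.eq_swap]
    exact key h
  · exact key h

/-! ### The truncated universal cover of an ABox -/

section Cover

variable {NC NR NI : Type}

/-- The role assertion that states `ρ(a,b)` for a role `ρ`. -/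
def Role.assertion : Role NR → NI → NI → Assertion NC NR NI
  | .name r, a, b => .role r a b
  | .inv r, a, b => .role r b a

theorem Role.assertion_inverse (ρ : Role NR) (a b : NI) :
    (ρ.inverse.assertion b a : Assertion NC NR NI) = ρ.assertion a b := by
  cases ρ <;> rfl

theorem Role.assertion_inj {ρ σ : Role NR} {a b c d : NI}
    (h : (ρ.assertion a b : Assertion NC NR NI) = σ.assertion c d) :
    (ρ = σ ∧ a = c ∧ b = d) ∨ (ρ = σ.inverse ∧ a = d ∧ b = c) := by
  cases ρ <;> cases σ <;> simp_all [Role.assertion, Role.inverse]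

theorem Interpretation.satAssertion_role (I : Interpretation NC NR NI) (ρ : Role NR) (a b : NI) :
    I.SatAssertion (ρ.assertion a b) ↔ (I.ind a, I.ind b) ∈ I.role ρ := by
  cases ρ <;> exact Iff.rfl

/-- A word over the oriented edges of an ABox, the last edge first. -/
abbrev EdgeWord (NR NI : Type) : Type := List (NI × Role NR × NI)

namespace ABox

variable (A : ABox NC NR NI)

/-- The words that describe a walk from `c` to a given individual that never
uses an assertion backwards immediately after using it. -/
inductive Walk (c : NI) : EdgeWord NR NI → NI → Prop
  | nil : Walk c [] c
  | cons {v : EdgeWord NR NI} {a b : NI} {ρ : Role NR} : Walk c v a → ρ.assertion a b ∈ A →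
      v.head? ≠ some (b, ρ.inverse, a) → Walk c ((a, ρ, b) :: v) b

variable {A}

open Classical in
/-- Extends a walk by an edge, or cancels the edge against its inverse. -/
noncomputable def walkStep (a : NI) (ρ : Role NR) (b : NI) (v : EdgeWord NR NI) :
    EdgeWord NR NI :=
  if v.head? = some (b, ρ.inverse, a) then v.tail else (a, ρ, b) :: v

theorem Walk.step {a b c : NI} {ρ : Role NR} {v : EdgeWord NR NI} (hv : A.Walk c v a)
    (h : ρ.assertion a b ∈ A) : A.Walk c (walkStep a ρ b v) b := by
  unfold walkStep
  split_ifs with hh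
  · cases hv with
    | nil => simp at hh
    | cons hv _ _ =>
      simp only [List.head?_cons, Option.some.injEq, Prod.mk.injEq] at hh
      obtain ⟨rfl, -, -⟩ := hh
      exact hv
  · exact hv.cons h hh

/-- If the first step cancels an edge, the second restores it, because the walk was reduced. Thus an
assertion gives a bijection between the walks to its two ends. -/
theorem Walk.step_step {a b c : NI} {ρ : Role NR} {v : EdgeWord NR NI} (hv : A.Walk c v a) :
    walkStep b ρ.inverse a (walkStep a ρ b v) = v := by
  unfold walkStep
  by_cases hh : v.head? = some (b, ρ.inverse, a)
  · cases hv with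
    | nil => simp at hh
    | cons _ _ hn =>
      simp only [List.head?_cons, Option.some.injEq, Prod.mk.injEq] at hh
      obtain ⟨rfl, rfl, -⟩ := hh
      rw [if_pos List.head?_cons, List.tail_cons, if_neg hn]
  · simp [hh]

theorem length_walkStep_le (a : NI) (ρ : Role NR) (b : NI) (v : EdgeWord NR NI) :
    (walkStep a ρ b v).length ≤ v.length + 1 := by
  unfold walkStep
  split_ifs
  · simp; omega
  · simp

/-- The last individual of a walk that starts at `c`. -/
def endpoint (c : NI) : EdgeWord NR NI → NI
  | [] => c
  | e :: _ => e.2.2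

theorem Walk.endpoint_eq {c a : NI} {v : EdgeWord NR NI} (h : A.Walk c v a) :
    endpoint c v = a := by
  cases h <;> rfl

theorem Walk.walkStep_cons {c a b : NI} {ρ : Role NR} {v : EdgeWord NR NI}
    (h : A.Walk c ((a, ρ, b) :: v) b) : walkStep a ρ b v = (a, ρ, b) :: v := by
  cases h with
  | cons _ _ hn => exact if_neg hn

theorem finite_walks (A : ABox NC NR NI) (c : NI) (n : ℕ) :
    {v : EdgeWord NR NI | v.length ≤ n ∧ ∃ b, A.Walk c v b}.Finite := by
  have hE : {e : NI × Role NR × NI |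
      (e.2.1.assertion e.1 e.2.2 : Assertion NC NR NI) ∈ A}.Finite := by
    have h1 : {e : NI × NR × NI |
        (Assertion.role e.2.1 e.1 e.2.2 : Assertion NC NR NI) ∈ A}.Finite := by
      refine Set.Finite.preimage (f := fun e : NI × NR × NI =>
        (Assertion.role e.2.1 e.1 e.2.2 : Assertion NC NR NI)) ?_ A.finite_toSet
      rintro ⟨_, _, _⟩ - ⟨_, _, _⟩ - h
      simp_all
    refine ((h1.image fun e => (e.1, Role.name e.2.1, e.2.2)).union
      (h1.image fun e => (e.2.2, Role.inv e.2.1, e.1))).subset ?_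
    rintro ⟨a, ρ | ρ, b⟩ h
    · exact .inl ⟨(a, ρ, b), h, rfl⟩
    · exact .inr ⟨(b, ρ, a), h, rfl⟩
  induction n with
  | zero =>
    refine (Set.finite_singleton []).subset ?_
    rintro v ⟨hv, -⟩
    simpa using hv
  | succ n ih =>
    refine ((Set.finite_singleton []).union (hE.image2 List.cons ih)).subset ?_
    rintro v ⟨hl, b, hv⟩
    cases hv with
    | nil => exact .inl rfl
    | cons hv h _ =>
      exact .inr ⟨_, h, _, ⟨by simpa using hl, _, hv⟩, rfl⟩

variable (A) (ι : EdgeWord NR NI → NI)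

/-- The assertions of the universal cover of an ABox at `c`, up to depth `n`. -/
def coverSet (c : NI) (n : ℕ) : Set (Assertion NC NR NI) :=
  {α | (∃ B b v, v.length ≤ n ∧ A.Walk c v b ∧ Assertion.concept B b ∈ A ∧
      α = .concept B (ι v)) ∨
    ∃ ρ a b v, v.length + 1 ≤ n ∧ A.Walk c ((a, ρ, b) :: v) b ∧
      α = ρ.assertion (ι v) (ι ((a, ρ, b) :: v))}

theorem finite_coverSet (c : NI) (n : ℕ) : (A.coverSet ι c n).Finite := by
  have hC : {B : NC | ∃ b, (Assertion.concept B b : Assertion NC NR NI) ∈ A}.Finite := by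
    refine ((A.finite_toSet.image fun α : Assertion NC NR NI =>
      match α with
      | .concept B _ => some B
      | .role _ _ _ => none).preimage (Option.some_injective NC).injOn).subset ?_
    rintro B ⟨b, hb⟩
    exact ⟨_, hb, rfl⟩
  have hw := A.finite_walks c n
  refine ((hC.image2 (fun B v => Assertion.concept B (ι v)) hw).union
    ((hw.image fun v => match v with
      | [] => none
      | (a, ρ, b) :: v => some (ρ.assertion (ι v) (ι ((a, ρ, b) :: v)))).preimage
        (Option.some_injective (Assertion NC NR NI)).injOn)).subset ?_
  rintro α (⟨B, b, v, hl, hv, hB, rfl⟩ | ⟨ρ, a, b, v, hl, hv, rfl⟩)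
  · exact .inl ⟨B, ⟨b, hB⟩, v, ⟨hl, b, hv⟩, rfl⟩
  · exact .inr ⟨_, ⟨by simpa using hl, b, hv⟩, rfl⟩

/-- The universal cover of an ABox at `c`, up to depth `n`, with the walks renamed
by `ι`. -/
noncomputable def cover (c : NI) (n : ℕ) : ABox NC NR NI := (A.finite_coverSet ι c n).toFinset

variable {A ι}

theorem mem_cover {c : NI} {n : ℕ} {α : Assertion NC NR NI} :
    α ∈ A.cover ι c n ↔ α ∈ A.coverSet ι c n :=
  Set.Finite.mem_toFinset _

theorem concept_mem_cover {c : NI} {n : ℕ} {B : NC} {d : NI} :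
    Assertion.concept B d ∈ A.cover ι c n ↔
      ∃ b v, v.length ≤ n ∧ A.Walk c v b ∧ Assertion.concept B b ∈ A ∧ d = ι v := by
  rw [mem_cover]
  constructor
  · rintro (⟨B', b, v, hl, hv, hB, h⟩ | ⟨ρ, a, b, v, -, -, h⟩)
    · cases h
      exact ⟨b, v, hl, hv, hB, rfl⟩
    · cases ρ <;> cases h
  · rintro ⟨b, v, hl, hv, hB, rfl⟩
    exact .inl ⟨B, b, v, hl, hv, hB, rfl⟩

theorem role_mem_cover {c : NI} {n : ℕ} {σ : Role NR} {d e : NI} :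
    σ.assertion d e ∈ A.cover ι c n ↔
      ∃ ρ a b v, v.length + 1 ≤ n ∧ A.Walk c ((a, ρ, b) :: v) b ∧
        (σ.assertion d e : Assertion NC NR NI) = ρ.assertion (ι v) (ι ((a, ρ, b) :: v)) := by
  rw [mem_cover]
  constructor
  · rintro (⟨B', b, v, hl, hv, hB, h⟩ | h)
    · cases σ <;> cases h
    · exact h
  · exact .inr

/-- Read in either direction, an edge of the cover is a `walkStep` along an assertion of `A`. This
is the covering projection, injective on the edges at a vertex. -/
theorem exists_walk_of_mem_cover {c : NI} {n : ℕ} {σ : Role NR} {d e : NI}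
    (h : σ.assertion d e ∈ A.cover ι c n) :
    ∃ a b v, A.Walk c v a ∧ σ.assertion a b ∈ A ∧ d = ι v ∧ e = ι (walkStep a σ b v) := by
  obtain ⟨ρ, a, b, v, -, hv, h⟩ := role_mem_cover.1 h
  have hs := hv.walkStep_cons
  cases hv with
  | cons hv' hA hn =>
    rcases Role.assertion_inj h with ⟨rfl, rfl, rfl⟩ | ⟨rfl, rfl, rfl⟩
    · exact ⟨a, b, v, hv', hA, rfl, by rw [hs]⟩
    · refine ⟨b, a, _, hv'.cons hA hn, by rwa [Role.assertion_inverse], rfl, ?_⟩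
      rw [← hs, hv'.step_step]

/-- Every assertion at `a` lifts to each walk to `a`, provided the truncation leaves room for one
more edge. -/
theorem Walk.mem_cover {c a b : NI} {n : ℕ} {ρ : Role NR} {v : EdgeWord NR NI}
    (hv : A.Walk c v a) (hl : v.length + 1 ≤ n) (h : ρ.assertion a b ∈ A) :
    ρ.assertion (ι v) (ι (walkStep a ρ b v)) ∈ A.cover ι c n := by
  rw [role_mem_cover]
  unfold walkStep
  split_ifs with hh
  · cases hv with
    | nil => simp at hh
    | @cons v a' _ σ hv hA hn =>
      simp only [List.head?_cons, Option.some.injEq, Prod.mk.injEq] at hh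
      obtain ⟨rfl, rfl, -⟩ := hh
      refine ⟨_, _, _, v, ?_, hv.cons hA hn, ?_⟩
      · simp at hl; omega
      · rw [← Role.assertion_inverse, List.tail_cons]
  · exact ⟨_, _, _, v, hl, hv.cons h hh, rfl⟩

theorem Over.cover {Γ : Signature NC NR} (hA : A.Over Γ) (c : NI) (n : ℕ) :
    (A.cover ι c n).Over Γ := by
  refine ⟨fun B d h => ?_, fun r d e h => ?_⟩
  · obtain ⟨b, -, -, -, hB, -⟩ := concept_mem_cover.1 h
    exact hA.1 _ _ hB
  · obtain ⟨a, b, -, -, h, -⟩ := exists_walk_of_mem_cover (σ := .name r) h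
    exact hA.2 _ _ _ h

theorem cover_eq_empty {c : NI} (hc : c ∉ A.ind) (n : ℕ) : A.cover ι c n = ∅ := by
  have hr : ∀ {v b}, A.Walk c v b → b = c ∧ v = [] := by
    intro v b hv
    induction hv with
    | nil => exact ⟨rfl, rfl⟩
    | @cons v a b ρ _ h _ ih =>
      refine absurd ⟨_, h, ?_⟩ hc
      rw [← ih.1]
      cases ρ <;> simp [Role.assertion, Assertion.inds]
  ext α
  simp only [Finset.notMem_empty, iff_false]
  rw [ABox.mem_cover]
  rintro (⟨B, b, v, hl, hv, hB, rfl⟩ | ⟨ρ, a, b, v, hl, hv, rfl⟩)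
  · obtain ⟨rfl, -⟩ := hr hv
    exact hc ⟨_, hB, rfl⟩
  · exact absurd (hr hv).2 (by simp)

theorem mem_ind_of_role {ρ : Role NR} {a b : NI} (h : ρ.assertion a b ∈ A) :
    a ∈ A.ind ∧ b ∈ A.ind := by
  constructor <;> refine ⟨_, h, ?_⟩ <;> cases ρ <;> simp [Role.assertion, Assertion.inds]

theorem exists_walk_of_mem_ind_cover {c d : NI} {n : ℕ} (h : d ∈ (A.cover ι c n).ind) :
    ∃ v b, v.length ≤ n ∧ A.Walk c v b ∧ d = ι v := by
  obtain ⟨α, hα, hd⟩ := h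
  rw [ABox.mem_cover] at hα
  rcases hα with ⟨B, b, v, hl, hv, -, rfl⟩ | ⟨ρ, a, b, v, hl, hv, rfl⟩
  · exact ⟨v, b, hl, hv, hd⟩
  · have hd : d = ι v ∨ d = ι ((a, ρ, b) :: v) := by
      cases ρ <;> simp only [Role.assertion, Assertion.inds, Set.mem_insert_iff,
        Set.mem_singleton_iff] at hd <;> tauto
    rcases hd with rfl | rfl
    · cases hv with
      | cons hv _ _ => exact ⟨v, a, by omega, hv, rfl⟩
    · exact ⟨_, b, by simpa using hl, hv, rfl⟩

theorem root_mem_ind_cover {c : NI} (hc : c ∈ A.ind) (n : ℕ) :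
    ι [] ∈ (A.cover ι c (n + 1)).ind := by
  have role : ∀ {ρ : Role NR} {b}, ρ.assertion c b ∈ A → ι [] ∈ (A.cover ι c (n + 1)).ind :=
    fun h => (mem_ind_of_role (Walk.nil.mem_cover (by simp) h)).1
  obtain ⟨⟨B, b⟩ | ⟨r, a, b⟩, hα, hb⟩ := hc
  · obtain rfl : c = b := hb
    exact ⟨_, concept_mem_cover.2 ⟨_, _, by simp, .nil, hα, rfl⟩, rfl⟩
  · rcases hb with rfl | hb
    · exact role (ρ := .name r) hα
    · obtain rfl : c = b := hb
      exact role (ρ := .inv r) hα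

/-- The vertices are labelled by walks, and an edge joins a walk to its extension by one letter.
Depth at least one ensures that the root occurs even if no concept assertion mentions `c`. -/
theorem treeShaped_cover (hι : Function.Injective ι) {c : NI} (hc : c ∈ A.ind) (n : ℕ) :
    (A.cover ι c (n + 1)).TreeShaped := by
  have hstep : ∀ {r : NR} {d e : NI}, Assertion.role r d e ∈ A.cover ι c (n + 1) →
      ∃ ρ a b v, (Assertion.role r d e : Assertion NC NR NI) =
        Role.assertion ρ (ι v) (ι ((a, ρ, b) :: v)) := by
    intro r d e h
    obtain ⟨ρ, a, b, v, -, -, h⟩ := role_mem_cover (σ := .name r).1 h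
    exact ⟨ρ, a, b, v, h⟩
  have hcons : ∀ {v w : EdgeWord NR NI} {e}, w = e :: v → ι v ≠ ι w := by
    rintro v w e rfl h
    simpa using congrArg List.length (hι h)
  refine ⟨fun r d h => ?_, ⟨?_, ?_⟩, ?_⟩
  · obtain ⟨ρ, a, b, v, h⟩ := hstep h
    rcases Role.assertion_inj (ρ := .name r) h with ⟨-, h1, h2⟩ | ⟨-, h1, h2⟩
    · exact hcons rfl (h1.symm.trans h2)
    · exact hcons rfl (h2.symm.trans h1)
  · rw [SimpleGraph.connected_iff_exists_forall_reachable]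
    refine ⟨⟨_, root_mem_ind_cover hc n⟩, ?_⟩
    rintro ⟨d, hd⟩
    obtain ⟨v, b, hl, hv, rfl⟩ := exists_walk_of_mem_ind_cover hd
    induction hv with
    | nil => rfl
    | @cons v a b ρ hv h hn ih =>
      have hm := hv.mem_cover (ι := ι) (n := n + 1) (by simpa using hl) h
      rw [(hv.cons h hn).walkStep_cons] at hm
      refine (ih (by simp at hl; omega) (mem_ind_of_role hm).1).trans (SimpleGraph.Adj.reachable ?_)
      refine (SimpleGraph.fromRel_adj _ _ _).2 ⟨?_, ?_⟩
      · exact fun h => hcons rfl (congrArg Subtype.val h)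
      · cases ρ with
        | name r => exact .inl ⟨r, hm⟩
        | inv r => exact .inr ⟨r, hm⟩
  · have hinv : ∀ d : (A.cover ι c (n + 1)).ind, ∃ v, d.1 = ι v := fun d =>
      let ⟨v, _, _, _, h⟩ := exists_walk_of_mem_ind_cover d.2
      ⟨v, h⟩
    choose f hf using hinv
    have hrel : ∀ {r : NR} {x y}, Assertion.role r x.1 y.1 ∈ A.cover ι c (n + 1) →
        ∃ e, f y = e :: f x ∨ f x = e :: f y := by
      intro r x y h
      obtain ⟨ρ, a, b, v, h⟩ := hstep h
      rw [hf, hf] at h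
      rcases Role.assertion_inj (ρ := .name r) h with ⟨-, h1, h2⟩ | ⟨-, h1, h2⟩ <;>
        rw [hι h1, hι h2]
      · exact ⟨_, .inl rfl⟩
      · exact ⟨_, .inr rfl⟩
    refine isAcyclic_of_list_label f ?_ ?_
    · intro x y h
      exact Subtype.ext (by rw [hf, hf, h])
    · intro x y h
      obtain ⟨-, ⟨r, h⟩ | ⟨r, h⟩⟩ := (SimpleGraph.fromRel_adj _ _ _).1 h
      · exact hrel h
      · obtain ⟨e, h⟩ := hrel h
        exact ⟨e, h.symm⟩
  · intro r s d e d' e' h h' hde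
    obtain ⟨ρ, a, b, v, h⟩ := hstep h
    obtain ⟨ρ', a', b', v', h'⟩ := hstep h'
    -- The longer walk of an edge determines the assertion, and the crossed alternative is
    -- impossible by length.
    have key : (ι v = ι v' ∧ ι ((a, ρ, b) :: v) = ι ((a', ρ', b') :: v')) ∨
        (ι v = ι ((a', ρ', b') :: v') ∧ ι ((a, ρ, b) :: v) = ι v') := by
      rcases Role.assertion_inj (ρ := .name r) h with ⟨-, rfl, rfl⟩ | ⟨-, rfl, rfl⟩ <;>
      rcases Role.assertion_inj (ρ := .name s) h' with ⟨-, rfl, rfl⟩ | ⟨-, rfl, rfl⟩ <;>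
      tauto
    rw [h, h']
    rcases key with ⟨h1, h2⟩ | ⟨h1, h2⟩
    · have := hι h2
      simp only [List.cons.injEq, Prod.mk.injEq] at this
      obtain ⟨⟨rfl, rfl, rfl⟩, rfl⟩ := this
      rfl
    · have h3 := congrArg List.length (hι h1)
      have h4 := congrArg List.length (hι h2)
      simp at h3 h4
      omega

end ABox

/-- A model of an ABox and a TBox unravels into a model of the cover of the ABox. -/
theorem exists_model_cover [Nonempty NI] {T : TBox NC NR} (hT : T.FunctionalRolesHaveNoSubroles)
    {A : ABox NC NR NI} {ι : EdgeWord NR NI → NI} (hι : Function.Injective ι)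
    {I : Interpretation NC NR NI} (hIT : I.ModelsTBox T) (hIA : I.ModelsABox A) (c : NI) (n : ℕ) :
    ∃ M : Interpretation NC NR NI, M.ModelsTBox T ∧ M.ModelsABox (A.cover ι c n) ∧
      ∃ h : M.Δ → I.Δ, h (M.ind (ι [])) = I.ind c ∧
        (∀ B d, d ∈ M.conc B → h d ∈ I.conc B) ∧
        ∀ r d e, (d, e) ∈ M.rel r → (h d, h e) ∈ I.rel r := by
  -- Names of walks look like the endpoints of the walks. Names that `ι` does not use need some
  -- point, and `I.ind c` is an arbitrary default.
  let x : NI → I.Δ := Function.extend ι (fun v => I.ind (ABox.endpoint c v)) fun _ => I.ind c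
  have hx : ∀ {v b}, A.Walk c v b → x (ι v) = I.ind b := fun hv => by
    rw [show x (ι _) = _ from hι.extend_apply _ _ _, hv.endpoint_eq]
  have hedge : ∀ {ρ : Role NR} {d e}, ρ.assertion d e ∈ A.cover ι c n →
      (x d, x e) ∈ I.role ρ := by
    intro ρ d e h
    obtain ⟨a, b, v, hv, hA, rfl, rfl⟩ := ABox.exists_walk_of_mem_cover h
    rw [hx hv, hx (hv.step hA)]
    exact (I.satAssertion_role _ _ _).1 (hIA _ hA)
  let S : Core T I NI :=
    { edge := fun ρ d e => ρ.assertion d e ∈ A.cover ι c n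
      point := x
      nbr := fun _ _ e => x e
      edge_inverse := fun h => by rwa [Role.assertion_inverse]
      nbr_mem := hedge
      nbr_ext := fun _ _ => Iff.rfl
      functional := by
        intro ρ d e e' hρ h h'
        obtain ⟨a, b, v, hv, hA, rfl, rfl⟩ := ABox.exists_walk_of_mem_cover h
        obtain ⟨a', b', v', hv', hA', he, rfl⟩ := ABox.exists_walk_of_mem_cover h'
        obtain rfl := hι he
        obtain rfl : a = a' := by rw [← hv.endpoint_eq, ← hv'.endpoint_eq]
        -- Functionality in `I` and distinctness of individuals leave one `ρ`-neighbour of `a` in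
        -- `A`, hence one lift.
        obtain rfl : b = b' := I.ind_injective (hIT.2.2 ρ hρ _ _ _
          ((I.satAssertion_role _ _ _).1 (hIA _ hA)) ((I.satAssertion_role _ _ _).1 (hIA _ hA')))
        rfl
      models := hIT }
  refine ⟨S.graft, S.graft_modelsTBox hT, S.graft_modelsABox ?_ fun _ _ _ h => h,
    fun m => S.val m.1.1 m.1.2, hx .nil, fun B d h => h, ?_⟩
  · intro B d h
    obtain ⟨b, v, -, hv, hB, rfl⟩ := ABox.concept_mem_cover.1 h
    rw [show S.point (ι v) = _ from hx hv]
    exact hIA _ hB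
  · intro r m m' h
    change (S.val m.1.1 m.1.2, S.val m'.1.1 m'.1.2) ∈ I.role (.name r)
    rcases Core.Step.cases_val (ρ := .name r) h with ⟨h1, h2, σ, hs, he⟩ | ⟨h, -⟩
    · rw [show m.1.2 = [] from h1, show m'.1.2 = [] from h2]
      exact hs.satRI hIT (hedge he)
    · exact h

theorem Consistent.cover [Nonempty NI] {T : TBox NC NR} (hT : T.FunctionalRolesHaveNoSubroles)
    {A : ABox NC NR NI} {ι : EdgeWord NR NI → NI} (hι : Function.Injective ι)
    (h : Consistent T A) (c : NI) (n : ℕ) : Consistent T (A.cover ι c n) := by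
  obtain ⟨I, hIT, hIA⟩ := h
  obtain ⟨M, hMT, hMA, -⟩ := exists_model_cover hT hι hIT hIA c n
  exact ⟨M, hMT, hMA⟩

/-- A match in the unravelled model is pushed forward along the homomorphism that sends the root to
`c`. -/
theorem CertainAnswer.of_cover [Nonempty NI] {T : TBox NC NR}
    (hT : T.FunctionalRolesHaveNoSubroles) {A : ABox NC NR NI} {ι : EdgeWord NR NI → NI}
    (hι : Function.Injective ι) {c : NI} {n : ℕ} {p : CQ NC NR}
    (h : CertainAnswer T (A.cover ι c n) p (p.answer.map fun _ => ι [])) :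
    CertainAnswer T A p (p.answer.map fun _ => c) := by
  intro I hIT hIA
  obtain ⟨M, hMT, hMA, f, hroot, hconc, hrel⟩ := exists_model_cover hT hι hIT hIA c n
  obtain ⟨π, hπ, hans⟩ := h M hMT hMA
  refine ⟨fun z => f (π z), ⟨fun B z hz => hconc _ _ (hπ.1 B z hz),
    fun r z z' hz => hrel _ _ _ (hπ.2 r z z' hz)⟩, ?_⟩
  rw [List.map_map, List.map_inj_left] at hans ⊢
  intro z hz
  rw [hans z hz]
  exact hroot

end Cover


/-! ### Reduced products and Horn concepts -/

section ReducedProduct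

variable {NC NR NI Ω β : Type}

/-- Equality of sections of a family of interpretations up to a filter; `β` indexes
the filters. -/
def reducedSetoid (fam : Ω → Interpretation NC NR NI) (l : β → Filter Ω) :
    Setoid (β × ∀ ω, (fam ω).Δ) where
  r x y := x.1 = y.1 ∧ ∀ᶠ ω in l x.1, x.2 ω = y.2 ω
  iseqv :=
    { refl := fun _ => ⟨rfl, .of_forall fun _ => rfl⟩
      symm := by
        rintro ⟨b, f⟩ ⟨b', g⟩ ⟨h, h'⟩
        obtain rfl : b = b' := h
        exact ⟨rfl, h'.mono fun _ h => h.symm⟩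
      trans := by
        rintro ⟨b, f⟩ ⟨b', g⟩ ⟨b'', k⟩ ⟨h, h₁⟩ ⟨h', h₂⟩
        obtain rfl : b = b' := h
        obtain rfl : b = b'' := h'
        exact ⟨rfl, h₁.mp (h₂.mono fun _ h₂ h₁ => h₁.trans h₂)⟩ }

/-- The disjoint union, over `b`, of the reduced products of a family of interpretations modulo
the filters `l b`. -/
def reducedProduct [Nonempty β] (fam : Ω → Interpretation NC NR NI) (l : β → Filter Ω) :
    Interpretation NC NR Empty where
  Δ := Quotient (reducedSetoid fam l)
  nonempty := ⟨Quotient.mk _ (Classical.arbitrary β, fun ω => (fam ω).nonempty.some)⟩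
  conc A := {x | ∃ b f, x = Quotient.mk _ (b, f) ∧ ∀ᶠ ω in l b, f ω ∈ (fam ω).conc A}
  rel r := {x | ∃ b f g, x = (Quotient.mk _ (b, f), Quotient.mk _ (b, g)) ∧
    ∀ᶠ ω in l b, (f ω, g ω) ∈ (fam ω).rel r}
  ind := Empty.elim
  ind_injective := fun x => x.elim

namespace reducedProduct

variable [Nonempty β] {fam : Ω → Interpretation NC NR NI} {l : β → Filter Ω}

variable (fam l) in
/-- The element of the reduced product given by a section. -/
def mk (b : β) (f : ∀ ω, (fam ω).Δ) : (reducedProduct fam l).Δ :=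
  Quotient.mk (reducedSetoid fam l) (b, f)

theorem exists_mk (x : (reducedProduct fam l).Δ) : ∃ b f, x = mk fam l b f := by
  obtain ⟨⟨b, f⟩, rfl⟩ := Quotient.exists_rep x
  exact ⟨b, f, rfl⟩

theorem mk_eq_mk {b b' : β} {f g : ∀ ω, (fam ω).Δ} :
    mk fam l b f = mk fam l b' g ↔ b = b' ∧ ∀ᶠ ω in l b, f ω = g ω :=
  Quotient.eq (r := reducedSetoid fam l)

theorem mk_mem_conc {b : β} {f : ∀ ω, (fam ω).Δ} {A : NC} :
    mk fam l b f ∈ (reducedProduct fam l).conc A ↔ ∀ᶠ ω in l b, f ω ∈ (fam ω).conc A := by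
  constructor
  · rintro ⟨b', g, h, hg⟩
    obtain ⟨rfl, hfg⟩ := mk_eq_mk.1 h
    filter_upwards [hfg, hg] with ω hfg hg
    rwa [hfg]
  · exact fun h => ⟨b, f, rfl, h⟩

theorem mk_mem_role {b b' : β} {f g : ∀ ω, (fam ω).Δ} {ρ : Role NR} :
    (mk fam l b f, mk fam l b' g) ∈ (reducedProduct fam l).role ρ ↔
      b = b' ∧ ∀ᶠ ω in l b, (f ω, g ω) ∈ (fam ω).role ρ := by
  have key : ∀ {r : NR} {b b' : β} {f g : ∀ ω, (fam ω).Δ},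
      (mk fam l b f, mk fam l b' g) ∈ (reducedProduct fam l).rel r ↔
      b = b' ∧ ∀ᶠ ω in l b, (f ω, g ω) ∈ (fam ω).rel r := by
    intro r b b' f g
    constructor
    · rintro ⟨c, f', g', h, h'⟩
      obtain ⟨h₁, h₂⟩ := Prod.mk.inj h
      obtain ⟨rfl, hf⟩ := mk_eq_mk.1 h₁
      obtain ⟨rfl, hg⟩ := mk_eq_mk.1 h₂
      refine ⟨rfl, ?_⟩
      filter_upwards [hf, hg, h'] with ω hf hg h'
      rwa [hf, hg]
    · rintro ⟨rfl, h⟩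
      exact ⟨b, f, g, rfl, h⟩
  cases ρ with
  | name r => exact key
  | inv r =>
    refine Iff.trans key ⟨?_, ?_⟩
    · rintro ⟨rfl, h⟩
      exact ⟨rfl, h⟩
    · rintro ⟨rfl, h⟩
      exact ⟨rfl, h⟩

theorem exists_mk_of_role {b : β} {f : ∀ ω, (fam ω).Δ} {x : (reducedProduct fam l).Δ}
    {ρ : Role NR} (h : (mk fam l b f, x) ∈ (reducedProduct fam l).role ρ) :
    ∃ g, x = mk fam l b g ∧ ∀ᶠ ω in l b, (f ω, g ω) ∈ (fam ω).role ρ := by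
  obtain ⟨b', g, rfl⟩ := exists_mk x
  obtain ⟨rfl, hg⟩ := mk_mem_role.1 h
  exact ⟨g, rfl, hg⟩

/-- One half of Łoś's theorem, which needs no ultrafilter: left-hand concepts are positive
existential. -/
theorem eventually_of_mem_ext [∀ b, (l b).NeBot] {C : Concept NC NR} (hC : C.IsLeft) {b : β}
    {f : ∀ ω, (fam ω).Δ} (h : mk fam l b f ∈ (reducedProduct fam l).ext C) :
    ∀ᶠ ω in l b, f ω ∈ (fam ω).ext C := by
  induction hC generalizing f with
  | top => exact .of_forall fun _ => trivial
  | bot => exact absurd h id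
  | atom A => exact mk_mem_conc.1 h
  | inf _ _ ihC ihD => exact (ihC h.1).and (ihD h.2)
  | sup _ _ ihC ihD =>
    rcases h with h | h
    · exact (ihC h).mono fun _ => Or.inl
    · exact (ihD h).mono fun _ => Or.inr
  | ex r _ ih =>
    obtain ⟨x, hr, hx⟩ := h
    obtain ⟨g, rfl, hg⟩ := exists_mk_of_role hr
    exact hg.mp ((ih hx).mono fun ω h hr => ⟨g ω, hr, h⟩)

/-- The other half. The only disjunctions are implications from a left-hand concept, and these are
handled by `eventually_of_mem_ext`. -/
theorem mem_ext_of_eventually [∀ b, (l b).NeBot] {C : Concept NC NR} (hC : C.IsRight) {b : β}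
    {f : ∀ ω, (fam ω).Δ} (h : ∀ᶠ ω in l b, f ω ∈ (fam ω).ext C) :
    mk fam l b f ∈ (reducedProduct fam l).ext C := by
  induction hC generalizing f with
  | top => trivial
  | bot => exact absurd h.exists fun ⟨_, h⟩ => h
  | atom A => exact mk_mem_conc.2 h
  | negAtom A =>
    intro hA
    obtain ⟨ω, h, hA⟩ := (h.and (mk_mem_conc.1 hA)).exists
    exact h hA
  | inf _ _ ihC ihD => exact ⟨ihC (h.mono fun _ h => h.1), ihD (h.mono fun _ h => h.2)⟩
  | @negSup C D hC _ ih =>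
    by_cases hm : mk fam l b f ∈ (reducedProduct fam l).ext C
    · exact .inr (ih (h.mp ((eventually_of_mem_ext hC hm).mono
        fun _ hC h => h.resolve_left fun h => h hC)))
    · exact .inl hm
  | @ex r C _ ih =>
    -- A section of witnesses, with the default `f ω` at coordinates where there is none.
    have : ∀ ω, ∃ e, f ω ∈ (fam ω).ext (.ex r C) → (f ω, e) ∈ (fam ω).role r ∧
        e ∈ (fam ω).ext C := by
      intro ω
      by_cases h : f ω ∈ (fam ω).ext (.ex r C)
      · obtain ⟨e, he⟩ := h
        exact ⟨e, fun _ => he⟩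
      · exact ⟨f ω, fun h' => absurd h' h⟩
    choose g hg using this
    exact ⟨mk fam l b g, mk_mem_role.2 ⟨rfl, h.mono fun ω h => (hg ω h).1⟩,
      ih (h.mono fun ω h => (hg ω h).2)⟩
  | all r _ ih =>
    intro x hx
    obtain ⟨g, rfl, hr⟩ := exists_mk_of_role hx
    exact ih (h.mp (hr.mono fun ω hr h => h _ hr))

/-- Reduced products of models of a Horn TBox are models. -/
theorem modelsTBox [∀ b, (l b).NeBot] {T : TBox NC NR} (h : ∀ ω, (fam ω).ModelsTBox T) :
    (reducedProduct fam l).ModelsTBox T := by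
  refine ⟨fun p hp x hx => ?_, fun p hp => ?_, fun ρ hρ => ?_⟩
  · obtain ⟨b, f, rfl⟩ := exists_mk x
    exact mem_ext_of_eventually (T.horn p hp).2
      ((eventually_of_mem_ext (T.horn p hp).1 hx).mono fun ω hω => (h ω).1 p hp hω)
  · rintro ⟨x, y⟩ hxy
    obtain ⟨b, f, rfl⟩ := exists_mk x
    obtain ⟨g, rfl, hr⟩ := exists_mk_of_role hxy
    exact mk_mem_role.2 ⟨rfl, hr.mono fun ω hr => (h ω).2.1 p hp hr⟩
  · intro x y y' hy hy'
    obtain ⟨b, f, rfl⟩ := exists_mk x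
    obtain ⟨g, rfl, hr⟩ := exists_mk_of_role hy
    obtain ⟨g', rfl, hr'⟩ := exists_mk_of_role hy'
    exact mk_eq_mk.2 ⟨rfl, hr.mp (hr'.mono fun ω hr' hr => (h ω).2.2 ρ hρ _ _ _ hr hr')⟩

end reducedProduct

/-- Concepts are invariant under a change of coordinates that carries one filter
into another. -/
theorem reducedProduct.mk_mem_ext_comp {κ V : Type} [Nonempty β]
    {J : κ → Interpretation NC NR NI} {l : β → Filter (κ × V)} {b c : β} {τ τ' : V → V}
    (hmap : ∀ s : κ × V → Prop, (∀ᶠ ω in l c, s ω) ↔ ∀ᶠ ω in l b, s (ω.1, τ ω.2))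
    (hinv : ∀ᶠ ω in l b, τ' (τ ω.2) = ω.2) (C : Concept NC NR) (f : ∀ ω : κ × V, (J ω.1).Δ) :
    mk (fun ω : κ × V => J ω.1) l c f ∈ (reducedProduct (fun ω : κ × V => J ω.1) l).ext C ↔
      mk (fun ω : κ × V => J ω.1) l b (fun ω => f (ω.1, τ ω.2)) ∈
        (reducedProduct (fun ω : κ × V => J ω.1) l).ext C := by
  have forth : ∀ {r : Role NR} {f : ∀ ω : κ × V, (J ω.1).Δ}
      {x : (reducedProduct (fun ω : κ × V => J ω.1) l).Δ},
      (mk (fun ω : κ × V => J ω.1) l c f, x) ∈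
        (reducedProduct (fun ω : κ × V => J ω.1) l).role r →
      ∃ g, x = mk (fun ω : κ × V => J ω.1) l c g ∧
        (mk (fun ω : κ × V => J ω.1) l b (fun ω => f (ω.1, τ ω.2)),
          mk (fun ω : κ × V => J ω.1) l b (fun ω => g (ω.1, τ ω.2))) ∈
            (reducedProduct (fun ω : κ × V => J ω.1) l).role r := by
    intro r f x h
    obtain ⟨g, rfl, hg⟩ := exists_mk_of_role h
    exact ⟨g, rfl, mk_mem_role.2
      ⟨rfl, (hmap fun ω => (f ω, g ω) ∈ (J ω.1).role r).1 hg⟩⟩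
  have back : ∀ {r : Role NR} {f : ∀ ω : κ × V, (J ω.1).Δ}
      {x : (reducedProduct (fun ω : κ × V => J ω.1) l).Δ},
      (mk (fun ω : κ × V => J ω.1) l b (fun ω => f (ω.1, τ ω.2)), x) ∈
        (reducedProduct (fun ω : κ × V => J ω.1) l).role r →
      ∃ g, x = mk (fun ω : κ × V => J ω.1) l b (fun ω => g (ω.1, τ ω.2)) ∧
        (mk (fun ω : κ × V => J ω.1) l c f, mk (fun ω : κ × V => J ω.1) l c g) ∈
            (reducedProduct (fun ω : κ × V => J ω.1) l).role r := by
    intro r f x h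
    obtain ⟨g, rfl, hfg⟩ := exists_mk_of_role h
    have hg : ∀ᶠ ω in l b, g ω = g (ω.1, τ' (τ ω.2)) := by
      refine hinv.mono fun ω hω => ?_
      obtain ⟨k, v⟩ := ω
      dsimp only at hω ⊢
      rw [hω]
    -- Since `τ'` undoes `τ` eventually, every section over `b` is the pullback of one over `c`.
    refine ⟨fun ω => g (ω.1, τ' ω.2), mk_eq_mk.2 ⟨rfl, hg⟩, mk_mem_role.2 ⟨rfl, ?_⟩⟩
    refine (hmap fun ω => (f ω, g (ω.1, τ' ω.2)) ∈ (J ω.1).role r).2 ?_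
    filter_upwards [hfg, hg] with ω h hg
    rwa [← hg]
  induction C generalizing f with
  | top => exact Iff.rfl
  | bot => exact Iff.rfl
  | atom A =>
    exact mk_mem_conc.trans ((hmap fun ω => f ω ∈ (J ω.1).conc A).trans mk_mem_conc.symm)
  | neg C ih => exact not_congr (ih f)
  | inf C D ihC ihD => exact and_congr (ihC f) (ihD f)
  | sup C D ihC ihD => exact or_congr (ihC f) (ihD f)
  | ex r C ih =>
    constructor
    · rintro ⟨x, hr, hx⟩
      obtain ⟨g, rfl, h⟩ := forth hr
      exact ⟨_, h, (ih g).1 hx⟩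
    · rintro ⟨x, hr, hx⟩
      obtain ⟨g, rfl, h⟩ := back hr
      exact ⟨_, h, (ih g).2 hx⟩
  | all r C ih =>
    constructor
    · intro h x hr
      obtain ⟨g, rfl, hg⟩ := back hr
      exact (ih g).1 (h _ hg)
    · intro h x hr
      obtain ⟨g, rfl, hg⟩ := forth hr
      exact (ih g).2 (h _ hg)

end ReducedProduct

/-! ### A canonical core from models of all truncated covers -/

section Canonical

variable {NC NR NI : Type}

/-- The filter of sets that contain all walks from some `c` to `b` that are far from the boundary
of the cover of depth `n`, where `(c, p, n)` is the first component of the index. -/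
def ABox.walkFilter (A : ABox NC NR NI) (b : NI) :
    Filter ((NI × CQ NC NR × ℕ) × EdgeWord NR NI) where
  sets := {s | ∃ N, ∀ c p n v, A.Walk c v b → v.length + N ≤ n → ((c, p, n), v) ∈ s}
  univ_sets := ⟨0, fun _ _ _ _ _ _ => trivial⟩
  sets_of_superset := fun ⟨N, h⟩ hs => ⟨N, fun c p n v hv hl => hs (h c p n v hv hl)⟩
  inter_sets := fun ⟨N, h⟩ ⟨N', h'⟩ => ⟨N + N', fun c p n v hv hl =>
    ⟨h c p n v hv (by omega), h' c p n v hv (by omega)⟩⟩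

variable {A : ABox NC NR NI}

instance ABox.walkFilter_neBot (b : NI) : (A.walkFilter b).NeBot := by
  refine ⟨fun h => ?_⟩
  obtain ⟨N, h⟩ := Filter.empty_mem_iff_bot.2 h
  exact h b ⟨[], ∅, ∅, by simp, by simp⟩ N [] .nil (by simp)

/-- A step changes the length of a walk by at most one, which the arbitrary margin `N` absorbs. By
`Walk.step_step` steps are invertible. -/
theorem ABox.eventually_walkFilter_step {b c : NI} {ρ : Role NR} (h : ρ.assertion b c ∈ A)
    (s : (NI × CQ NC NR × ℕ) × EdgeWord NR NI → Prop) :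
    (∀ᶠ ω in A.walkFilter c, s ω) ↔
      ∀ᶠ ω in A.walkFilter b, s (ω.1, ABox.walkStep b ρ c ω.2) := by
  constructor
  · rintro ⟨N, hN⟩
    refine ⟨N + 1, fun d p n v hv hl => hN _ _ _ _ (hv.step h) ?_⟩
    have := length_walkStep_le b ρ c v
    dsimp only
    omega
  · rintro ⟨N, hN⟩
    refine ⟨N + 1, fun d p n v hv hl => ?_⟩
    have h' : ρ.inverse.assertion c b ∈ A := by rwa [Role.assertion_inverse]
    have h1 := length_walkStep_le c ρ.inverse b v
    have h2 : s ((d, p, n), ABox.walkStep b ρ c (ABox.walkStep c ρ.inverse b v)) :=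
      hN d p n (ABox.walkStep c ρ.inverse b v) (hv.step h') (by omega)
    have h3 := hv.step_step (b := b) (ρ := ρ.inverse)
    rw [Role.inverse_inverse] at h3
    rwa [h3] at h2

/-- A model of `T`, with a point for every individual, in which a tree-shaped piece of a query
holds at the point of `b` only if it is certain over the cover of the ABox at `b`. -/
theorem exists_canonical_core [Nonempty NI] {T : TBox NC NR}
    (hT : T.FunctionalRolesHaveNoSubroles) {ι : EdgeWord NR NI → NI}
    (hι : Function.Injective ι) (hA : Consistent T A) :
    ∃ (P : Interpretation NC NR Empty) (S : Core T P NI),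
      (∀ ρ b c, S.edge ρ b c ↔ ρ.assertion b c ∈ A) ∧
      (∀ B b, Assertion.concept B b ∈ A → S.point b ∈ P.conc B) ∧
      ∀ (b : NI) (p : CQ NC NR) (φ : ℕ → P.Δ), p.IsMatch P φ →
        (∀ z ∈ p.answer, φ z = S.point b) →
        (∀ z ∈ p.vars,
          Relation.ReflTransGen (fun d e => ∃ ρ, (d, e) ∈ P.role ρ) (S.point b) (φ z)) →
        ∃ n, CertainAnswer T (A.cover ι b (n + 1)) p (p.answer.map fun _ => ι []) := by
  -- Each index carries a countermodel to its own query whenever there is one, so that truth of the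
  -- query in `J` amounts to certainty.
  have hJ : ∀ κ : NI × CQ NC NR × ℕ, ∃ J : Interpretation NC NR NI, J.ModelsTBox T ∧
      J.ModelsABox (A.cover ι κ.1 (κ.2.2 + 1)) ∧
      (J.SatCQ κ.2.1 (κ.2.1.answer.map fun _ => ι []) →
        CertainAnswer T (A.cover ι κ.1 (κ.2.2 + 1)) κ.2.1 (κ.2.1.answer.map fun _ => ι [])) := by
    rintro ⟨c, p, n⟩
    by_cases h : CertainAnswer T (A.cover ι c (n + 1)) p (p.answer.map fun _ => ι [])
    · obtain ⟨J, hJT, hJA⟩ := hA.cover hT hι c (n + 1)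
      exact ⟨J, hJT, hJA, fun _ => h⟩
    · simp only [CertainAnswer, not_forall] at h
      obtain ⟨J, hJT, hJA, hq⟩ := h
      exact ⟨J, hJT, hJA, fun h => absurd h hq⟩
  choose J hJT hJA hJq using hJ
  let fam : (NI × CQ NC NR × ℕ) × EdgeWord NR NI → Interpretation NC NR NI := fun ω => J ω.1
  let x : ∀ ω, (fam ω).Δ := fun ω => (J ω.1).ind (ι ω.2)
  let P := reducedProduct fam A.walkFilter
  let S : Core T P NI :=
    { edge := fun ρ b c => ρ.assertion b c ∈ A
      point := fun b => reducedProduct.mk fam A.walkFilter b x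
      -- The points of `b` and `c` lie in different summands of the disjoint union. The neighbour of
      -- `b` is therefore the copy of the point of `c` in the summand of `b`, transported by
      -- `walkStep`.
      nbr := fun ρ b c => reducedProduct.mk fam A.walkFilter b
        fun ω => (J ω.1).ind (ι (ABox.walkStep b ρ c ω.2))
      edge_inverse := fun h => by rwa [Role.assertion_inverse]
      nbr_mem := fun {ρ b c} h => reducedProduct.mk_mem_role.2 ⟨rfl, 0, fun d p n v hv hl =>
        ((J (d, p, n)).satAssertion_role _ _ _).1
          (hJA (d, p, n) _ (hv.mem_cover (by simpa using hl) h))⟩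
      nbr_ext := fun {ρ b c} h C => reducedProduct.mk_mem_ext_comp (J := J)
        (τ := ABox.walkStep b ρ c) (τ' := ABox.walkStep c ρ.inverse b)
        (ABox.eventually_walkFilter_step h) ⟨0, fun d p n v hv _ => hv.step_step⟩ C x
      functional := by
        intro ρ b c c' hρ h h'
        obtain ⟨I, hIT, hIA⟩ := hA
        exact I.ind_injective (hIT.2.2 ρ hρ _ _ _ ((I.satAssertion_role _ _ _).1 (hIA _ h))
          ((I.satAssertion_role _ _ _).1 (hIA _ h')))
      models := reducedProduct.modelsTBox fun ω => hJT ω.1 }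
  refine ⟨P, S, fun _ _ _ => Iff.rfl, fun B b hB => ?_, fun b p φ hφ hans hreach => ?_⟩
  · exact reducedProduct.mk_mem_conc.2 ⟨0, fun d p n v hv hl => hJA (d, p, n) _
      (ABox.concept_mem_cover.2 ⟨b, v, by dsimp only; omega, hv, hB, rfl⟩)⟩
  -- Role edges never leave a summand, so everything reachable from the point of `b` is given by a
  -- section over `b`.
  · have hmk : ∀ z, ∃ f, z ∈ p.vars → φ z = reducedProduct.mk fam A.walkFilter b f := by
      intro z
      by_cases hz : z ∈ p.vars
      · suffices ∃ f, φ z = reducedProduct.mk fam A.walkFilter b f from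
          this.imp fun f h _ => h
        have := hreach z hz
        generalize φ z = d at this
        induction this with
        | refl => exact ⟨x, rfl⟩
        | tail _ h ih =>
          obtain ⟨f, rfl⟩ := ih
          obtain ⟨ρ, h⟩ := h
          obtain ⟨g, rfl, -⟩ := reducedProduct.exists_mk_of_role h
          exact ⟨g, rfl⟩
      · exact ⟨x, fun h => absurd h hz⟩
    choose f hf using hmk
    have hatoms : ∀ᶠ ω in A.walkFilter b, ∀ α ∈ p.atoms, match α with
        | .concept B z => f z ω ∈ (fam ω).conc B
        | .role r z z' => (f z ω, f z' ω) ∈ (fam ω).rel r := by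
      rw [Filter.eventually_all_finset]
      rintro (⟨B, z⟩ | ⟨r, z, z'⟩) hα
      · have := hφ.1 B z hα
        rw [hf z (p.closed _ hα _ rfl)] at this
        exact reducedProduct.mk_mem_conc.1 this
      · have := hφ.2 r z z' hα
        rw [hf z (p.closed _ hα _ (.inl rfl)), hf z' (p.closed _ hα _ (.inr rfl))] at this
        exact (reducedProduct.mk_mem_role (ρ := .name r).1 this).2
    have hanswer : ∀ᶠ ω in A.walkFilter b, ∀ z ∈ p.answer.toFinset, f z ω = x ω := by
      rw [Filter.eventually_all_finset]
      intro z hz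
      rw [List.mem_toFinset] at hz
      have := hans z hz
      rw [hf z (.inl hz)] at this
      exact (reducedProduct.mk_eq_mk.1 this).2
    obtain ⟨N, hN⟩ := hatoms.and hanswer
    -- The margin `N` serves as the depth: at index `(b, p, N)` and the empty walk, the sections
    -- give a match of `p` at the root in the model chosen against `p`.
    obtain ⟨h1, h2⟩ := hN b p N [] .nil (by simp)
    refine ⟨N, hJq (b, p, N) ⟨fun z => f z ((b, p, N), []),
      ⟨fun B z hz => h1 _ hz, fun r z z' hz => h1 _ hz⟩, ?_⟩⟩
    rw [List.map_map, List.map_inj_left]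
    exact fun z hz => h2 z (List.mem_toFinset.2 hz)

end Canonical


/-! ### Tree-shaped pieces of a matched query -/

section Pieces

variable {NC NR NI : Type}

/-- The graph on the image of a query under `π` given by the role atoms that have an end
outside `D`. -/
def CQ.imageGraph {V : Type} (q : CQ NC NR) (π : ℕ → V) (D : Set V) : SimpleGraph V :=
  SimpleGraph.fromRel fun x y => ¬ (x ∈ D ∧ y ∈ D) ∧
    ∃ r z z', QAtom.role r z z' ∈ q.atoms ∧ π z = x ∧ π z' = y

/-- The variable that represents an element of the image of a query under `π`. -/
noncomputable def CQ.rep {V : Type} (q : CQ NC NR) (π : ℕ → V) (x : V) : ℕ :=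
  Function.invFunOn π q.vars x

theorem CQ.apply_rep {V : Type} {q : CQ NC NR} {π : ℕ → V} {z : ℕ} (hz : z ∈ q.vars) :
    π (q.rep π (π z)) = π z :=
  Function.invFunOn_eq ⟨z, hz, rfl⟩

theorem CQ.mem_vars_of_concept {q : CQ NC NR} {B : NC} {z : ℕ}
    (h : QAtom.concept B z ∈ q.atoms) : z ∈ q.vars :=
  q.closed _ h _ rfl

theorem CQ.mem_vars_of_role {q : CQ NC NR} {r : NR} {z z' : ℕ}
    (h : QAtom.role r z z' ∈ q.atoms) : z ∈ q.vars ∧ z' ∈ q.vars :=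
  ⟨q.closed _ h _ (.inl rfl), q.closed _ h _ (.inr rfl)⟩

open Classical in
/-- The part of the image of a query under `π` that lies in a set `K`, as a query: role atoms with
both ends in `D` are dropped, and the elements of `E` become answer variables. -/
theorem CQ.exists_restriction {V : Type} (q : CQ NC NR) (π : ℕ → V) (D E K : Set V) :
    ∃ p : CQ NC NR,
      (∀ z, z ∈ p.vars ↔ ∃ w ∈ q.vars, π w ∈ K ∧ z = q.rep π (π w)) ∧
      (∀ z, z ∈ p.answer ↔ ∃ w ∈ q.vars, π w ∈ K ∧ π w ∈ E ∧ z = q.rep π (π w)) ∧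
      p.answer.Nodup ∧
      (∀ B z, QAtom.concept B z ∈ p.atoms ↔
        ∃ w, QAtom.concept B w ∈ q.atoms ∧ π w ∈ K ∧ z = q.rep π (π w)) ∧
      (∀ r z z', QAtom.role r z z' ∈ p.atoms ↔ ∃ w w', QAtom.role r w w' ∈ q.atoms ∧
        (π w ∈ K ∧ π w' ∈ K ∧ ¬ (π w ∈ D ∧ π w' ∈ D)) ∧
        z = q.rep π (π w) ∧ z' = q.rep π (π w')) := by
  let keep : QAtom NC NR → Prop
    | .concept _ z => π z ∈ K
    | .role _ z z' => π z ∈ K ∧ π z' ∈ K ∧ ¬ (π z ∈ D ∧ π z' ∈ D)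
  let rename : QAtom NC NR → QAtom NC NR
    | .concept B z => .concept B (q.rep π (π z))
    | .role r z z' => .role r (q.rep π (π z)) (q.rep π (π z'))
  let vars : Finset ℕ :=
    ((q.answer.toFinset ∪ q.quantified).filter fun z => π z ∈ K).image fun z => q.rep π (π z)
  let ans : Finset ℕ :=
    ((q.answer.toFinset ∪ q.quantified).filter fun z => π z ∈ K ∧ π z ∈ E).image
      fun z => q.rep π (π z)
  have hvars : ∀ z, z ∈ vars ↔ ∃ w ∈ q.vars, π w ∈ K ∧ z = q.rep π (π w) := by
    intro z
    simp [vars, CQ.vars, and_assoc, eq_comm]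
  have hans : ∀ z, z ∈ ans ↔ ∃ w ∈ q.vars, π w ∈ K ∧ π w ∈ E ∧ z = q.rep π (π w) := by
    intro z
    simp [ans, CQ.vars, and_assoc, eq_comm]
  have hconc : ∀ B z, QAtom.concept B z ∈ (q.atoms.filter keep).image rename ↔
      ∃ w, QAtom.concept B w ∈ q.atoms ∧ π w ∈ K ∧ z = q.rep π (π w) := by
    intro B z
    simp only [Finset.mem_image, Finset.mem_filter]
    constructor
    · rintro ⟨⟨B', w⟩ | ⟨r, w, w'⟩, ⟨h, hk⟩, he⟩ <;> cases he
      exact ⟨w, h, hk, rfl⟩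
    · rintro ⟨w, h, hk, rfl⟩
      exact ⟨_, ⟨h, hk⟩, rfl⟩
  have hrole : ∀ r z z', QAtom.role r z z' ∈ (q.atoms.filter keep).image rename ↔
      ∃ w w', QAtom.role r w w' ∈ q.atoms ∧ (π w ∈ K ∧ π w' ∈ K ∧ ¬ (π w ∈ D ∧ π w' ∈ D)) ∧
        z = q.rep π (π w) ∧ z' = q.rep π (π w') := by
    intro r z z'
    simp only [Finset.mem_image, Finset.mem_filter]
    constructor
    · rintro ⟨⟨B', w⟩ | ⟨r, w, w'⟩, ⟨h, hk⟩, he⟩ <;> cases he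
      exact ⟨w, w', h, hk, rfl, rfl⟩
    · rintro ⟨w, w', h, hk, rfl, rfl⟩
      exact ⟨_, ⟨h, hk⟩, rfl⟩
  have hsplit : ∀ z, z ∈ vars ↔ z ∈ ans.toList ∨ z ∈ vars \ ans := by
    intro z
    have : z ∈ ans → z ∈ vars := by
      rw [hans, hvars]
      rintro ⟨w, hw, hk, -, h⟩
      exact ⟨w, hw, hk, h⟩
    simp only [Finset.mem_toList, Finset.mem_sdiff]
    tauto
  refine ⟨⟨ans.toList, vars \ ans, (q.atoms.filter keep).image rename, ?_, ?_⟩,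
    fun z => (hsplit z).symm.trans (hvars z), fun z => Finset.mem_toList.trans (hans z),
    Finset.nodup_toList _, hconc, hrole⟩
  · intro z hz
    simp [Finset.mem_toList.1 hz]
  · rintro (⟨B, z⟩ | ⟨r, z, z'⟩) hα y hy
    · obtain rfl : y = z := hy
      obtain ⟨w, hw, hk, h⟩ := (hconc _ _).1 hα
      exact (hsplit y).1 ((hvars y).2 ⟨w, CQ.mem_vars_of_concept hw, hk, h⟩)
    · obtain ⟨w, w', hw, hk, h, h'⟩ := (hrole _ _ _).1 hα
      rcases hy with hy | hy
      · obtain rfl : y = z := hy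
        exact (hsplit y).1 ((hvars y).2 ⟨w, (CQ.mem_vars_of_role hw).1, hk.1, h⟩)
      · obtain rfl : y = z' := hy
        exact (hsplit y).1 ((hvars y).2 ⟨w', (CQ.mem_vars_of_role hw).2, hk.2.1, h'⟩)

/-- If a query is mapped into a forest with roots `D`, up to role atoms between roots, then the
restriction of its image to a connected component is weakly tree-shaped. -/
theorem CQ.weaklyTreeShaped_restriction {V α β : Type} {q p : CQ NC NR} {π : ℕ → V} {D : Set V}
    (label : V → β × List α) (hlabel : Function.Injective label)
    (hadj : ∀ r z z', QAtom.role r z z' ∈ q.atoms → ¬ (π z ∈ D ∧ π z' ∈ D) →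
      (label (π z)).1 = (label (π z')).1 ∧
        ∃ e, (label (π z')).2 = e :: (label (π z)).2 ∨ (label (π z)).2 = e :: (label (π z')).2)
    {z₀ : ℕ} (hz₀ : z₀ ∈ q.vars)
    (hvars : ∀ z, z ∈ p.vars ↔ ∃ w ∈ q.vars, (q.imageGraph π D).Reachable (π z₀) (π w) ∧
      z = q.rep π (π w))
    (hrole : ∀ r z z', QAtom.role r z z' ∈ p.atoms ↔ ∃ w w', QAtom.role r w w' ∈ q.atoms ∧
      ((q.imageGraph π D).Reachable (π z₀) (π w) ∧ (q.imageGraph π D).Reachable (π z₀) (π w') ∧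
        ¬ (π w ∈ D ∧ π w' ∈ D)) ∧ z = q.rep π (π w) ∧ z' = q.rep π (π w')) :
    p.WeaklyTreeShaped ∧
      ∀ x, (q.imageGraph π D).Reachable (π z₀) x → (label x).1 = (label (π z₀)).1 := by
  have hne : ∀ {r z z'}, QAtom.role r z z' ∈ q.atoms → ¬ (π z ∈ D ∧ π z' ∈ D) →
      π z ≠ π z' := by
    intro r z z' h hD he
    obtain ⟨-, e, h | h⟩ := hadj r z z' h hD <;> simp [he] at h
  have hroot : ∀ x, (q.imageGraph π D).Reachable (π z₀) x →
      (label x).1 = (label (π z₀)).1 := by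
    intro x hx
    rw [SimpleGraph.reachable_iff_reflTransGen] at hx
    induction hx with
    | refl => rfl
    | tail _ h ih =>
      rw [← ih]
      obtain ⟨-, ⟨hD, r, z, z', hr, rfl, rfl⟩ | ⟨hD, r, z, z', hr, rfl, rfl⟩⟩ :=
        (SimpleGraph.fromRel_adj _ _ _).1 h
      · exact (hadj _ _ _ hr hD).1.symm
      · exact (hadj _ _ _ hr hD).1
  have hpi : ∀ {w}, w ∈ q.vars → π (q.rep π (π w)) = π w := CQ.apply_rep
  refine ⟨⟨?_, ?_, ?_⟩, hroot⟩
  · intro r z h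
    obtain ⟨w, w', h, ⟨-, -, hD⟩, h1, h2⟩ := (hrole _ _ _).1 h
    have hv := CQ.mem_vars_of_role h
    exact hne h hD (by rw [← hpi hv.1, ← h1, h2, hpi hv.2])
  · rw [SimpleGraph.connected_iff_exists_forall_reachable]
    refine ⟨⟨q.rep π (π z₀), (hvars _).2 ⟨z₀, hz₀, .rfl, rfl⟩⟩, ?_⟩
    suffices ∀ x, (q.imageGraph π D).Reachable (π z₀) x → ∀ h, p.graph.Reachable
        ⟨q.rep π (π z₀), (hvars _).2 ⟨z₀, hz₀, .rfl, rfl⟩⟩ ⟨q.rep π x, h⟩ by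
      rintro ⟨d, hd⟩
      obtain ⟨w, hw, hr, rfl⟩ := (hvars d).1 hd
      exact this _ hr _
    intro x hx
    rw [SimpleGraph.reachable_iff_reflTransGen] at hx
    induction hx with
    | refl => exact fun _ => .rfl
    | @tail x y hx hxy ih =>
      intro hy
      rw [← SimpleGraph.reachable_iff_reflTransGen] at hx
      have hxy' := hx.trans hxy.reachable
      obtain ⟨-, ⟨hD, r, z, z', h, rfl, rfl⟩ | ⟨hD, r, z, z', h, rfl, rfl⟩⟩ :=
        (SimpleGraph.fromRel_adj _ _ _).1 hxy
      · have hv := CQ.mem_vars_of_role h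
        refine (ih ((hvars _).2 ⟨z, hv.1, hx, rfl⟩)).trans (SimpleGraph.Adj.reachable ?_)
        refine (SimpleGraph.fromRel_adj _ _ _).2 ⟨fun he => hne h hD ?_,
          .inl ⟨r, (hrole _ _ _).2 ⟨z, z', h, ⟨hx, hxy', hD⟩, rfl, rfl⟩⟩⟩
        rw [← hpi hv.1, ← hpi hv.2]
        exact congrArg π (congrArg Subtype.val he)
      · have hv := CQ.mem_vars_of_role h
        refine (ih ((hvars _).2 ⟨z', hv.2, hx, rfl⟩)).trans (SimpleGraph.Adj.reachable ?_)
        refine (SimpleGraph.fromRel_adj _ _ _).2 ⟨fun he => hne h hD ?_,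
          .inr ⟨r, (hrole _ _ _).2 ⟨z, z', h, ⟨hxy', hx, hD⟩, rfl, rfl⟩⟩⟩
        rw [← hpi hv.1, ← hpi hv.2]
        exact congrArg π (congrArg Subtype.val he).symm
  · refine isAcyclic_of_list_label (fun z => (label (π z.1)).2) ?_ ?_
    -- Inside a component the root is constant, so the list part of the label alone is injective.
    · rintro ⟨z, hz⟩ ⟨z', hz'⟩ h
      obtain ⟨w, hw, hr, rfl⟩ := (hvars z).1 hz
      obtain ⟨w', hw', hr', rfl⟩ := (hvars z').1 hz'
      dsimp only at h
      rw [hpi hw, hpi hw'] at h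
      have : π w = π w' := hlabel (Prod.ext ((hroot _ hr).trans (hroot _ hr').symm) h)
      exact Subtype.ext (congrArg (q.rep π) this)
    · have key : ∀ {r z z'}, QAtom.role r z z' ∈ p.atoms → ∃ e,
          (label (π z')).2 = e :: (label (π z)).2 ∨ (label (π z)).2 = e :: (label (π z')).2 := by
        intro r z z' h
        obtain ⟨w, w', hr, ⟨-, -, hD⟩, rfl, rfl⟩ := (hrole _ _ _).1 h
        have hv := CQ.mem_vars_of_role hr
        rw [hpi hv.1, hpi hv.2]
        exact (hadj _ _ _ hr hD).2
      intro z z' h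
      obtain ⟨-, ⟨r, h⟩ | ⟨r, h⟩⟩ := (SimpleGraph.fromRel_adj _ _ _).1 h
      · exact key h
      · obtain ⟨e, h⟩ := key h
        exact ⟨e, h.symm⟩

end Pieces

/-! ### Gluing matches and extracting a tree-shaped witness -/

section Witness

variable {NC NR NI : Type}

/-- Supplies the reachability condition of `exists_canonical_core` for a piece inside one tree. -/
theorem Core.reflTransGen_val {NI' : Type} {T : TBox NC NR} {P : Interpretation NC NR NI'}
    {S : Core T P NI} {b : NI} {w : List (Role NR × P.Δ)} (h : S.Branch b w) :
    Relation.ReflTransGen (fun d e => ∃ ρ, (d, e) ∈ P.role ρ) (S.point b) (S.val b w) := by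
  induction h with
  | nil => exact .refl
  | cons _ hr _ ih => exact ih.tail ⟨_, hr⟩

/-- If all weakly tree-shaped queries with at most one answer variable that `T₂` entails over
covers of `A` are entailed by `T₁` over `A`, then `T₁` entails over `A` all queries that
`T₂` entails. -/
theorem certainAnswer_of_tree_queries [Nonempty NI] {SA SQ : Signature NC NR} {T₁ T₂ : TBox NC NR}
    (hT₂ : T₂.FunctionalRolesHaveNoSubroles) (hRI : RIEntails NI SA SQ T₁ T₂)
    {ι : EdgeWord NR NI → NI} (hι : Function.Injective ι) {A : ABox NC NR NI} (hA : A.Over SA)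
    (hA₂ : Consistent T₂ A) {q : CQ NC NR} (hq : q.Over SQ) {a : List NI}
    (ha : ∀ b ∈ a, b ∈ A.ind) (h₂ : CertainAnswer T₂ A q a)
    (htree : ∀ (b : NI) (n : ℕ) (p : CQ NC NR), p.WeaklyTreeShaped → p.answer.length ≤ 1 →
      p.Over SQ → (b ∈ A.ind ∨ p.answer = []) →
      CertainAnswer T₂ (A.cover ι b (n + 1)) p (p.answer.map fun _ => ι []) →
      CertainAnswer T₁ A p (p.answer.map fun _ => b)) :
    CertainAnswer T₁ A q a := by
  obtain ⟨P, S, hedge, hconc, hcert⟩ := exists_canonical_core hT₂ hι hA₂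
  obtain ⟨π, ⟨hπc, hπr⟩, hans⟩ := h₂ S.graft (S.graft_modelsTBox hT₂)
    (S.graft_modelsABox hconc fun r b c h => (hedge _ _ _).2 h)
  intro I hIT hIA
  let D : Set S.graft.Δ := {m | m.1.2 = []}
  -- The core contains all of `NI`, but only individuals of `A` may be answers. All elements of `E`
  -- become answer variables, even images of quantified variables, so that the pieces agree with the
  -- core edges when glued.
  let E : Set S.graft.Δ := {m | m.1.2 = [] ∧ m.1.1 ∈ A.ind}
  let G := q.imageGraph π D
  let ν : S.graft.Δ → P.Δ := fun m => S.val m.1.1 m.1.2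
  have hadj : ∀ r z z', QAtom.role r z z' ∈ q.atoms → ¬ (π z ∈ D ∧ π z' ∈ D) →
      (ν (π z), ν (π z')) ∈ P.role (.name r) ∧
      (π z).1.1 = (π z').1.1 ∧
      ∃ e, (π z').1.2 = e :: (π z).1.2 ∨ (π z).1.2 = e :: (π z').1.2 := by
    intro r z z' h hD
    rcases Core.Step.cases_val (ρ := .name r) (hπr r z z' h) with ⟨h1, h2, -⟩ | h
    · exact absurd ⟨h1, h2⟩ hD
    · exact h
  have hpiece : ∀ z₀, ∃ σ : ℕ → I.Δ, z₀ ∈ q.vars →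
      (∀ B z, QAtom.concept B z ∈ q.atoms → G.Reachable (π z₀) (π z) →
        σ (q.rep π (π z)) ∈ I.conc B) ∧
      (∀ r z z', QAtom.role r z z' ∈ q.atoms → ¬ (π z ∈ D ∧ π z' ∈ D) →
        G.Reachable (π z₀) (π z) → G.Reachable (π z₀) (π z') →
        (σ (q.rep π (π z)), σ (q.rep π (π z'))) ∈ I.rel r) ∧
      (∀ z ∈ q.vars, G.Reachable (π z₀) (π z) → π z ∈ E →
        σ (q.rep π (π z)) = I.ind (π z).1.1) := by
    intro z₀
    by_cases hz₀ : z₀ ∈ q.vars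
    swap
    · exact ⟨fun _ => I.nonempty.some, fun h => absurd h hz₀⟩
    obtain ⟨p, hpv, hpa, hnd, hpc, hpr⟩ :=
      q.exists_restriction π D E {x | G.Reachable (π z₀) x}
    obtain ⟨hwts, hroot⟩ := CQ.weaklyTreeShaped_restriction (p := p) Subtype.val
      Subtype.val_injective (fun r z z' h hD => (hadj r z z' h hD).2) hz₀ hpv hpr
    have hcore : ∀ w, G.Reachable (π z₀) (π w) → π w ∈ E → (π w).1 = ((π z₀).1.1, []) :=
      fun w hw hE => Prod.ext (hroot _ hw) hE.1
    have hlen : p.answer.length ≤ 1 := by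
      by_contra hl
      obtain ⟨z, z', l, hl⟩ : ∃ z z' l, p.answer = z :: z' :: l := by
        match h : p.answer with
        | [] => simp [h] at hl
        | [_] => simp [h] at hl
        | z :: z' :: l => exact ⟨z, z', l, rfl⟩
      obtain ⟨w, -, hw, hE, rfl⟩ := (hpa z).1 (by simp [hl])
      obtain ⟨w', -, hw', hE', rfl⟩ := (hpa z').1 (by simp [hl])
      have : π w = π w' := Subtype.ext ((hcore w hw hE).trans (hcore w' hw' hE').symm)
      rw [hl, this] at hnd
      simp at hnd
    have hover : p.Over SQ := by
      refine ⟨fun B z h => ?_, fun r z z' h => ?_⟩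
      · obtain ⟨w, hw, -⟩ := (hpc _ _).1 h
        exact hq.1 _ _ hw
      · obtain ⟨w, w', hw, -⟩ := (hpr _ _ _).1 h
        exact hq.2 _ _ _ hw
    obtain ⟨n, hn⟩ := hcert (π z₀).1.1 p (fun z => ν (π z))
      ⟨fun B z h => by
        obtain ⟨w, hw, -, rfl⟩ := (hpc _ _).1 h
        dsimp only
        rw [CQ.apply_rep (π := π) (CQ.mem_vars_of_concept hw)]
        exact hπc _ _ hw,
      fun r z z' h => by
        obtain ⟨w, w', hw, hk, rfl, rfl⟩ := (hpr _ _ _).1 h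
        have hv := CQ.mem_vars_of_role hw
        dsimp only
        rw [CQ.apply_rep (π := π) hv.1, CQ.apply_rep (π := π) hv.2]
        exact (hadj _ _ _ hw hk.2.2).1⟩
      (fun z h => by
        obtain ⟨w, hw, hk, hE, rfl⟩ := (hpa _).1 h
        rw [CQ.apply_rep (π := π) hw]
        exact congrArg (fun m : NI × _ => S.val m.1 m.2) (hcore w hk hE))
      (fun z h => by
        obtain ⟨w, hw, hk, rfl⟩ := (hpv _).1 h
        rw [CQ.apply_rep (π := π) hw, ← show (π w).1.1 = (π z₀).1.1 from hroot _ hk]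
        exact Core.reflTransGen_val (π w).2)
    have hb : (π z₀).1.1 ∈ A.ind ∨ p.answer = [] := by
      by_contra hcon
      rw [not_or] at hcon
      obtain ⟨z, hz⟩ := List.exists_mem_of_ne_nil _ hcon.2
      obtain ⟨w, hw, hk, hE, rfl⟩ := (hpa _).1 hz
      exact hcon.1 (hroot _ hk ▸ hE.2)
    obtain ⟨σ, ⟨hσc, hσr⟩, hσa⟩ := htree _ n p hwts hlen hover hb hn I hIT hIA
    rw [List.map_map, List.map_inj_left] at hσa
    refine ⟨σ, fun _ => ⟨fun B z h hr => hσc _ _ ((hpc _ _).2 ⟨z, h, hr, rfl⟩),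
      fun r z z' h hD hr hr' => hσr _ _ _ ((hpr _ _ _).2 ⟨z, z', h, ⟨hr, hr', hD⟩, rfl, rfl⟩),
      fun z hz hr hE => ?_⟩⟩
    rw [hσa _ ((hpa _).2 ⟨z, hz, hr, hE, rfl⟩), hroot _ hr]
    rfl
  choose σ hσ using hpiece
  let comp : ℕ → G.ConnectedComponent := fun z => G.connectedComponentMk (π z)
  -- One representative variable per component, so that all variables of a piece use the same match.
  let root : ℕ → ℕ := fun z => Function.invFunOn comp q.vars (comp z)
  have hroot_mem : ∀ {z}, z ∈ q.vars → root z ∈ q.vars :=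
    fun {z} hz => Function.invFunOn_mem ⟨z, hz, rfl⟩
  have hroot : ∀ {z}, z ∈ q.vars → G.Reachable (π (root z)) (π z) :=
    fun {z} hz => SimpleGraph.ConnectedComponent.exact
      (Function.invFunOn_eq (f := comp) ⟨z, hz, rfl⟩)
  have hind : ∀ z ∈ q.vars, π z ∈ E → σ (root z) (q.rep π (π z)) = I.ind (π z).1.1 :=
    fun z hz hE => (hσ _ (hroot_mem hz)).2.2 z hz (hroot hz) hE
  refine ⟨fun z => σ (root z) (q.rep π (π z)), ⟨fun B z h => ?_, fun r z z' h => ?_⟩, ?_⟩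
  · have hz := CQ.mem_vars_of_concept h
    exact (hσ _ (hroot_mem hz)).1 B z h (hroot hz)
  · obtain ⟨hz, hz'⟩ := CQ.mem_vars_of_role h
    by_cases hD : π z ∈ D ∧ π z' ∈ D
    · rcases Core.Step.cases_val (ρ := .name r) (hπr r z z' h) with
        ⟨-, -, ρ, hs, he⟩ | ⟨-, -, e, he | he⟩
      · rw [hedge] at he
        obtain ⟨hi, hi'⟩ := ABox.mem_ind_of_role he
        dsimp only
        rw [hind z hz ⟨hD.1, hi⟩, hind z' hz' ⟨hD.2, hi'⟩]
        -- A core edge is an ABox assertion for a subrole `ρ` of `r` under `T₂`. By the hypothesis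
        -- on role inclusions, `T₁` entails the same inclusion.
        refine hRI ρ (.name r) ?_ (hq.2 _ _ _ h) (fun J hJ => hs.satRI hJ) I hIT
          ((I.satAssertion_role _ _ _).1 (hIA _ he))
        cases ρ with
        | name s => exact hA.2 _ _ _ he
        | inv s => exact hA.2 _ _ _ he
      · exact absurd (he.symm.trans hD.2) (List.cons_ne_nil _ _)
      · exact absurd (he.symm.trans hD.1) (List.cons_ne_nil _ _)
    · have hne : π z ≠ π z' := by
        intro he
        obtain ⟨-, -, e, h | h⟩ := hadj r z z' h hD <;> simp [he] at h
      have hG : G.Adj (π z) (π z') :=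
        (SimpleGraph.fromRel_adj _ _ _).2 ⟨hne, .inl ⟨hD, r, z, z', h, rfl, rfl⟩⟩
      have hrt : root z' = root z :=
        congrArg (Function.invFunOn comp q.vars)
          (SimpleGraph.ConnectedComponent.sound hG.symm.reachable)
      dsimp only
      rw [hrt]
      exact (hσ _ (hroot_mem hz)).2.1 r z z' h hD (hroot hz) ((hroot hz).trans hG.reachable)
  · have : q.answer.map (fun z => σ (root z) (q.rep π (π z))) =
        (q.answer.map π).map fun m => I.ind m.1.1 := by
      rw [List.map_map, List.map_inj_left]
      intro z hz
      refine hind z (.inl hz) ?_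
      have := List.mem_map_of_mem (f := π) hz
      rw [hans, List.mem_map] at this
      obtain ⟨b, hb, hb'⟩ := this
      rw [← hb']
      exact ⟨rfl, ha b hb⟩
    rw [this, hans, List.map_map]
    rfl

/-- Every witness yields a witness with a weakly tree-shaped query with at most one answer
variable over a cover of the ABox, or over the empty ABox if the given ABox is empty. -/
theorem IsWitness.exists_tree_witness [Nonempty NI] {SA SQ : Signature NC NR}
    {T₁ T₂ : TBox NC NR} (hT₁ : T₁.FunctionalRolesHaveNoSubroles)
    (hT₂ : T₂.FunctionalRolesHaveNoSubroles) (hRI : RIEntails NI SA SQ T₁ T₂)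
    {ι : EdgeWord NR NI → NI} (hι : Function.Injective ι) {A : ABox NC NR NI} {q : CQ NC NR}
    {a : List NI} (hw : IsWitness SA SQ T₁ T₂ A q a) :
    ∃ (A' : ABox NC NR NI) (p : CQ NC NR) (a' : List NI), IsWitness SA SQ T₁ T₂ A' p a' ∧
      (A'.TreeShaped ∨ A = ∅ ∧ A' = ∅) ∧ p.WeaklyTreeShaped ∧ p.answer.length ≤ 1 := by
  obtain ⟨hA, hA₁, hA₂, hq, ha, h₂, h₁⟩ := hw
  by_contra hno
  refine h₁ (certainAnswer_of_tree_queries hT₂ hRI hι hA hA₂ hq ha h₂ ?_)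
  have hind : ∀ (b : NI) (n : ℕ) (p : CQ NC NR), p.WeaklyTreeShaped → p.answer.length ≤ 1 →
      p.Over SQ → b ∈ A.ind →
      CertainAnswer T₂ (A.cover ι b (n + 1)) p (p.answer.map fun _ => ι []) →
      CertainAnswer T₁ A p (p.answer.map fun _ => b) := by
    intro b n p hp hl hpq hb h
    -- If `T₁` missed the piece over the cover, the cover would be the desired tree-shaped witness.
    refine CertainAnswer.of_cover hT₁ hι (n := n + 1) (by_contra fun h' => hno ?_)
    refine ⟨_, p, _, ⟨hA.cover b (n + 1), hA₁.cover hT₁ hι b _, hA₂.cover hT₂ hι b _, hpq,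
      fun d hd => ?_, h, h'⟩, .inl (ABox.treeShaped_cover hι hb n), hp, hl⟩
    obtain ⟨-, -, rfl⟩ := List.mem_map.1 hd
    exact ABox.root_mem_ind_cover hb n
  intro b n p hp hl hpq hb h
  by_cases hbA : b ∈ A.ind
  · exact hind b n p hp hl hpq hbA h
  · have hnil := hb.resolve_left hbA
    rw [ABox.cover_eq_empty hbA, hnil, List.map_nil] at h
    rw [hnil, List.map_nil]
    rcases A.eq_empty_or_nonempty with rfl | ⟨α, hα⟩
    · by_contra h'
      exact hno ⟨∅, p, [], ⟨hA, hA₁, hA₂, hpq, by simp, h, h'⟩, .inr ⟨rfl, rfl⟩, hp, hl⟩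
    · obtain ⟨c, hc⟩ : ∃ c, c ∈ A.ind := by
        cases α with
        | concept B c => exact ⟨c, _, hα, rfl⟩
        | role r c d => exact ⟨c, _, hα, .inl rfl⟩
      -- A Boolean piece certain over the empty ABox is certain over every ABox, so it may be moved
      -- to the cover at any individual `c` of `A`.
      have := hind c 0 p hp hl hpq hc fun J hJ _ => by
        rw [hnil]
        exact h J hJ (by simp [Interpretation.ModelsABox])
      rwa [hnil] at this

theorem exists_injective_edgeWord [Countable NR] [Countable NI] [Infinite NI] :
    ∃ ι : EdgeWord NR NI → NI, Function.Injective ι := by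
  have : Countable (Role NR) := by
    refine Function.Injective.countable (β := NR × Bool) (f := fun r => match r with
      | .name r => (r, true)
      | .inv r => (r, false)) ?_
    rintro (r | r) (s | s) h <;> simp_all
  obtain ⟨f, hf⟩ := exists_injective_nat (EdgeWord NR NI)
  exact ⟨Infinite.natEmbedding NI ∘ f, (Infinite.natEmbedding NI).injective.comp hf⟩

end Witness

end HornDL

open HornDL

theorem mainTheorem8 {NC NR NI : Type} [Countable NC] [Infinite NC] [Countable NR] [Infinite NR]
    [Countable NI] [Infinite NI] (SA SQ : Signature NC NR) (T₁ T₂ : TBox NC NR)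
    (hT₁ : T₁.FunctionalRolesHaveNoSubroles) (hT₂ : T₂.FunctionalRolesHaveNoSubroles)
    (hRI : RIEntails NI SA SQ T₁ T₂) (hCQ : ¬ CQEntails NI SA SQ T₁ T₂) :
    ∃ (A : ABox NC NR NI) (q : CQ NC NR) (a : List NI),
      IsWitness SA SQ T₁ T₂ A q a ∧
      (A.TreeShaped ∨
        (A = ∅ ∧ ∀ (A' : ABox NC NR NI) (q' : CQ NC NR) (a' : List NI),
          IsWitness SA SQ T₁ T₂ A' q' a' → A' = ∅)) ∧
      q.WeaklyTreeShaped ∧ q.answer.length ≤ 1 := by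
  obtain ⟨ι, hι⟩ := exists_injective_edgeWord (NR := NR) (NI := NI)
  -- Starting from a nonempty witness, if there is one, rules out the degenerate alternative of
  -- `IsWitness.exists_tree_witness`.
  by_cases h : ∃ (A : ABox NC NR NI) (q : CQ NC NR) (a : List NI),
      IsWitness SA SQ T₁ T₂ A q a ∧ A ≠ ∅
  · obtain ⟨A, q, a, hw, hne⟩ := h
    obtain ⟨A', p, a', hw', hA', hp⟩ := hw.exists_tree_witness hT₁ hT₂ hRI hι
    exact ⟨A', p, a', hw', .inl (hA'.resolve_right fun h => hne h.1), hp⟩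
  · simp only [CQEntails, not_forall] at hCQ
    obtain ⟨A, hA, hA₁, hA₂, q, hq, a, ha, h₂, h₁⟩ := hCQ
    obtain ⟨A', p, a', hw', hA', hp⟩ :=
      IsWitness.exists_tree_witness hT₁ hT₂ hRI hι ⟨hA, hA₁, hA₂, hq, ha, h₂, h₁⟩
    refine ⟨A', p, a', hw', hA'.imp id fun h' => ⟨h'.2, fun B q' b hB => ?_⟩, hp⟩
    exact by_contra fun hne => h ⟨B, q', b, hB, hne⟩
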